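/- **Theorem 4.** Let $(M,g)$ be a non-empty smooth Riemannian manifold of dimension $n\ge 2$, let $A>0$, and let $\lambda,a_2,b_1,b_2:[0,\infty)\to\mathbb R$ be smooth functions with $\lambda(t)>0$ for all $t\ge 0$; put $a_1=A/\lambda$. On $T^*M$ use the local coordinates $(q^i,p_i)$ induced from charts of $M$, the energy density $t=\tfrac12 g^{ik}p_ip_k$, the quantities $g^{0i}=p_hg^{hi}$, and the adapted frame $\frac{\partial}{\partial p_i}$, $\frac{\delta}{\delta q^i}=\frac{\partial}{\partial q^i}+p_k\Gamma^k_{ih}\frac{\partial}{\partial p_h}$, where $\Gamma^k_{ih}$ are the Christoffel symbols of $g$. Let $J$ be the natural operator of diagonal type on $T^*M$ given by $$J\frac{\delta}{\delta q^i}=\bigl(a_1(t)g_{ij}+b_1(t)p_ip_j\bigr)\frac{\partial}{\partial p_j},\qquad J\frac{\partial}{\partial p_i}=-\bigl(a_2(t)g^{ij}+b_2(t)g^{0i}g^{0j}\bigr)\frac{\delta}{\delta q^j},$$ and assume that $J$ is an almost complex structure, i.e. $J^2=-I$. Then $J$ is integrable, i.e. its Nijenhuis tensor $N(X,Y)=[JX,JY]-J[JX,Y]-J[X,JY]-[X,Y]$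 vanishes, if and only if there is a constant $c\in\mathbb R$ such that $(M,g)$ has constant sectional curvature $c$ and, for all $t\ge 0$, $\lambda(t)+2t\lambda'(t)\neq 0$ and $$b_1(t)=-\frac{c\,\lambda(t)^3+A^2\lambda'(t)}{A\,\lambda(t)\,\bigl(\lambda(t)+2t\lambda'(t)\bigr)}.$$ Moreover, if $J$ is integrable and $(M,g)$ has constant sectional curvature $c$, then $\lambda$ satisfies $$\lambda(t)>0,\qquad \frac{A^2-2ct\,\lambda(t)^2}{\lambda(t)+2t\lambda'(t)}>0\quad\text{for all }t\ge 0,\qquad A>0.$$ -/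

import Mathlib

open Set
open scoped Manifold ContDiff

noncomputable section

namespace CotangentBundle

/-- Coordinate space: the local coordinates of an `n`-dimensional manifold live here, and so do
the component vectors of tangent and cotangent vectors. -/
abbrev Coord (n : ℕ) : Type := EuclideanSpace ℝ (Fin n)

/-- A smooth Riemannian metric on the smooth `n`-dimensional manifold `M`. -/
abbrev Metric (n : ℕ) (M : Type*) [TopologicalSpace M] [ChartedSpace (Coord n) M]
    [IsManifold (𝓡 n) ∞ M] : Type _ :=
  Bundle.ContMDiffRiemannianMetric (𝓡 n) ∞ (Coord n) (fun x : M => TangentSpace (𝓡 n) x)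

/-- The partial derivative `∂f/∂xⁱ` at `x`. -/
def partialDeriv {n : ℕ} (i : Fin n) (f : Coord n → ℝ) (x : Coord n) : ℝ :=
  fderiv ℝ f x (EuclideanSpace.single i 1)

section Chart

variable {n : ℕ} {M : Type*} [TopologicalSpace M] [ChartedSpace (Coord n) M]
  [IsManifold (𝓡 n) ∞ M]

/-- The coordinate vector `∂/∂xⁱ` of the chart `e`, at the point with coordinates `x`. -/
def coordVector (e : OpenPartialHomeomorph M (Coord n)) (x : Coord n) (i : Fin n) :
    TangentSpace (𝓡 n) (e.symm x) :=
  mfderiv (𝓡 n) (𝓡 n) e.symm x (EuclideanSpace.single i 1 : Coord n)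

/-- The matrix `(g_{ij})` of the metric in the chart `e`. -/
def metricMatrix (g : Metric n M) (e : OpenPartialHomeomorph M (Coord n)) (x : Coord n) :
    Matrix (Fin n) (Fin n) ℝ :=
  Matrix.of fun i j => g.inner (e.symm x) (coordVector e x i) (coordVector e x j)

/-- The inverse matrix `(g^{ij})`. -/
def inverseMetric (g : Metric n M) (e : OpenPartialHomeomorph M (Coord n)) (x : Coord n) :
    Matrix (Fin n) (Fin n) ℝ :=
  (metricMatrix g e x)⁻¹

/-- The Christoffel symbols `Γ^k_{ij}` of the Levi-Civita connection in the chart `e`. -/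
def christoffel (g : Metric n M) (e : OpenPartialHomeomorph M (Coord n)) (k i j : Fin n)
    (x : Coord n) : ℝ :=
  (1 / 2) * ∑ l, inverseMetric g e x k l *
    (partialDeriv i (fun y => metricMatrix g e y j l) x
      + partialDeriv j (fun y => metricMatrix g e y i l) x
      - partialDeriv l (fun y => metricMatrix g e y i j) x)

/-- The components `R^h_{kij}` of the curvature tensor in the chart `e`,
with `R(∂_i, ∂_j) ∂_k = R^h_{kij} ∂_h` and `R(X, Y) = [∇_X, ∇_Y] - ∇_{[X, Y]}`. -/
def curvature (g : Metric n M) (e : OpenPartialHomeomorph M (Coord n)) (h k i j : Fin n)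
    (x : Coord n) : ℝ :=
  partialDeriv i (christoffel g e h j k) x - partialDeriv j (christoffel g e h i k) x
    + ∑ l, (christoffel g e h i l x * christoffel g e l j k x
      - christoffel g e h j l x * christoffel g e l i k x)

/-- `g(u, v)` for tangent vectors with components `u`, `v`, at the point with coordinates `x`. -/
def metricForm (g : Metric n M) (e : OpenPartialHomeomorph M (Coord n)) (x u v : Coord n) : ℝ :=
  ∑ i, ∑ j, metricMatrix g e x i j * u i * v j

/-- The vector `R(u, v) w`, in components. -/
def curvatureVector (g : Metric n M) (e : OpenPartialHomeomorph M (Coord n))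
    (x u v w : Coord n) : Coord n :=
  WithLp.toLp 2 fun h => ∑ k, ∑ i, ∑ j, curvature g e h k i j x * w k * u i * v j

/-- The sectional curvature of the plane spanned by `u` and `v`. -/
def sectionalCurvature (g : Metric n M) (e : OpenPartialHomeomorph M (Coord n))
    (x u v : Coord n) : ℝ :=
  metricForm g e x (curvatureVector g e x u v v) u /
    (metricForm g e x u u * metricForm g e x v v - metricForm g e x u v ^ 2)

/-- `(M, g)` has constant sectional curvature `c`: every tangent plane at every point has
sectional curvature `c` (computed in any smooth chart around the point). -/
def HasConstantSectionalCurvature (g : Metric n M) (c : ℝ) : Prop :=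
  ∀ e ∈ IsManifold.maximalAtlas (𝓡 n) ∞ M, ∀ x ∈ e.target, ∀ u v : Coord n,
    LinearIndependent ℝ ![u, v] → sectionalCurvature g e x u v = c

/-! ### The cotangent bundle in induced charts

A chart `e` of `M` with domain `U` and coordinates `xⁱ` induces the chart
`(q¹, …, qⁿ, p₁, …, pₙ)` of `T^*M` with domain `π⁻¹(U)`, where `qⁱ = xⁱ ∘ π` and `p = pᵢ dxⁱ`. Its
image is `e.target × ℝⁿ`. Points `z = (q, p)`, tangent vectors and vector fields on `π⁻¹(U)` are
written in these coordinates. -/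

/-- The image of the chart of `T^*M` induced by `e`. -/
def inducedTarget (e : OpenPartialHomeomorph M (Coord n)) : Set (Coord n × Coord n) :=
  e.target ×ˢ univ

/-- The energy density `t = ½ g^{ik} pᵢ pₖ`. -/
def energy (g : Metric n M) (e : OpenPartialHomeomorph M (Coord n)) (z : Coord n × Coord n) : ℝ :=
  (1 / 2) * ∑ i, ∑ k, inverseMetric g e z.1 i k * z.2 i * z.2 k

/-- `g^{0i} = p_h g^{hi}`. -/
def raised (g : Metric n M) (e : OpenPartialHomeomorph M (Coord n)) (z : Coord n × Coord n)
    (i : Fin n) : ℝ :=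
  ∑ h, z.2 h * inverseMetric g e z.1 h i

/-- `Γ⁰_{ih} = p_k Γ^k_{ih}`. -/
def christoffelZero (g : Metric n M) (e : OpenPartialHomeomorph M (Coord n))
    (z : Coord n × Coord n) (i h : Fin n) : ℝ :=
  ∑ k, z.2 k * christoffel g e k i h z.1

/-- The vertical frame field `∂/∂pᵢ`. -/
def verticalFrame (i : Fin n) : Coord n × Coord n :=
  (0, EuclideanSpace.single i 1)

/-- The horizontal frame field `δ/δqⁱ = ∂/∂qⁱ + Γ⁰_{ih} ∂/∂p_h`. -/
def horizontalFrame (g : Metric n M) (e : OpenPartialHomeomorph M (Coord n))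
    (z : Coord n × Coord n) (i : Fin n) : Coord n × Coord n :=
  (EuclideanSpace.single i 1, 0) + ∑ h, christoffelZero g e z i h • verticalFrame h

/-- The 1-form `dqⁱ`. -/
def dq (i : Fin n) : Coord n × Coord n →L[ℝ] ℝ :=
  (EuclideanSpace.proj i : Coord n →L[ℝ] ℝ).comp (ContinuousLinearMap.fst ℝ (Coord n) (Coord n))

/-- The 1-form `dpᵢ`. -/
def dp (i : Fin n) : Coord n × Coord n →L[ℝ] ℝ :=
  (EuclideanSpace.proj i : Coord n →L[ℝ] ℝ).comp (ContinuousLinearMap.snd ℝ (Coord n) (Coord n))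

/-- The 1-form `Dpᵢ = dpᵢ - Γ⁰_{ij} dqʲ`; the forms `dqⁱ`, `Dpᵢ` are the frame dual to
`δ/δqⁱ`, `∂/∂pᵢ`. -/
def covariantDp (g : Metric n M) (e : OpenPartialHomeomorph M (Coord n))
    (z : Coord n × Coord n) (i : Fin n) : Coord n × Coord n →L[ℝ] ℝ :=
  dp i - ∑ j, christoffelZero g e z i j • dq j

/-- `J⁽¹⁾_{ij} = a₁(t) g_{ij} + b₁(t) pᵢ pⱼ`. -/
def lowerCoeff (g : Metric n M) (a₁ b₁ : ℝ → ℝ) (e : OpenPartialHomeomorph M (Coord n))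
    (z : Coord n × Coord n) (i j : Fin n) : ℝ :=
  a₁ (energy g e z) * metricMatrix g e z.1 i j + b₁ (energy g e z) * z.2 i * z.2 j

/-- `J₍₂₎^{ij} = a₂(t) g^{ij} + b₂(t) g^{0i} g^{0j}`. -/
def upperCoeff (g : Metric n M) (a₂ b₂ : ℝ → ℝ) (e : OpenPartialHomeomorph M (Coord n))
    (z : Coord n × Coord n) (i j : Fin n) : ℝ :=
  a₂ (energy g e z) * inverseMetric g e z.1 i j
    + b₂ (energy g e z) * raised g e z i * raised g e z j

/-- The natural operator of diagonal type `J` on `T^*M` with parameters `a₁, a₂, b₁, b₂`, at the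
point `z` of an induced chart:
`J δ/δqⁱ = J⁽¹⁾_{ij} ∂/∂pⱼ`, `J ∂/∂pᵢ = -J₍₂₎^{ij} δ/δqʲ`. -/
def naturalJ (g : Metric n M) (a₁ a₂ b₁ b₂ : ℝ → ℝ) (e : OpenPartialHomeomorph M (Coord n))
    (z : Coord n × Coord n) : Coord n × Coord n →L[ℝ] Coord n × Coord n :=
  ∑ i, (dq i).smulRight (∑ j, lowerCoeff g a₁ b₁ e z i j • verticalFrame j)
    + ∑ i, (covariantDp g e z i).smulRight
        (-∑ j, upperCoeff g a₂ b₂ e z i j • horizontalFrame g e z j)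

/-- `J δ/δqⁱ = J⁽¹⁾_{ij} ∂/∂pⱼ`. -/
theorem naturalJ_horizontalFrame (g : Metric n M) (a₁ a₂ b₁ b₂ : ℝ → ℝ)
    (e : OpenPartialHomeomorph M (Coord n)) (z : Coord n × Coord n) (i : Fin n) :
    naturalJ g a₁ a₂ b₁ b₂ e z (horizontalFrame g e z i)
      = ∑ j, lowerCoeff g a₁ b₁ e z i j • verticalFrame j := by
  have h1 : ∀ k, dq k (horizontalFrame g e z i) = if k = i then 1 else 0 := by
    intro k
    simp [dq, horizontalFrame, verticalFrame, Prod.fst_sum, PiLp.single_apply]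
  have h2 : ∀ k, covariantDp g e z k (horizontalFrame g e z i) = 0 := by
    intro k
    have hs : christoffelZero g e z i k = christoffelZero g e z k i := by
      unfold christoffelZero
      refine Finset.sum_congr rfl fun l _ => ?_
      congr 1
      unfold christoffel
      congr 1
      refine Finset.sum_congr rfl fun r _ => ?_
      have : (fun y => metricMatrix g e y i k) = fun y => metricMatrix g e y k i := by
        funext y
        exact g.symm _ _ _
      rw [this]
      ring
    simp [covariantDp, h1]
    simp [dp, horizontalFrame, verticalFrame, Prod.snd_sum, PiLp.single_apply, hs]
  simp [naturalJ, h1, h2]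

/-- `J ∂/∂pᵢ = -J₍₂₎^{ij} δ/δqʲ`. -/
theorem naturalJ_verticalFrame (g : Metric n M) (a₁ a₂ b₁ b₂ : ℝ → ℝ)
    (e : OpenPartialHomeomorph M (Coord n)) (z : Coord n × Coord n) (i : Fin n) :
    naturalJ g a₁ a₂ b₁ b₂ e z (verticalFrame i)
      = -∑ j, upperCoeff g a₂ b₂ e z i j • horizontalFrame g e z j := by
  have h1 : ∀ k : Fin n, dq k (verticalFrame i) = 0 := by
    intro k
    simp [dq, verticalFrame]
  have h2 : ∀ k, covariantDp g e z k (verticalFrame i) = if k = i then 1 else 0 := by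
    intro k
    simp [covariantDp, h1]
    simp [dp, verticalFrame, PiLp.single_apply]
  simp [naturalJ, h1, h2]

/-- `J` is an almost complex structure on `T^*M`, i.e. `J² = -I`. -/
def IsAlmostComplex (g : Metric n M) (a₁ a₂ b₁ b₂ : ℝ → ℝ) : Prop :=
  ∀ e ∈ IsManifold.maximalAtlas (𝓡 n) ∞ M, ∀ z ∈ inducedTarget e, ∀ w : Coord n × Coord n,
    naturalJ g a₁ a₂ b₁ b₂ e z (naturalJ g a₁ a₂ b₁ b₂ e z w) = -w

/-- The Nijenhuis tensor `N(X, Y) = [JX, JY] - J[JX, Y] - J[X, JY] - [X, Y]` of a field of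
endomorphisms `J`. -/
def nijenhuis {V : Type*} [NormedAddCommGroup V] [NormedSpace ℝ V] (J : V → V →L[ℝ] V)
    (X Y : V → V) (z : V) : V :=
  VectorField.lieBracket ℝ (fun y => J y (X y)) (fun y => J y (Y y)) z
    - J z (VectorField.lieBracket ℝ (fun y => J y (X y)) Y z)
    - J z (VectorField.lieBracket ℝ X (fun y => J y (Y y)) z)
    - VectorField.lieBracket ℝ X Y z

/-- `J` is integrable: its Nijenhuis tensor vanishes on all smooth vector fields on the domains
of the induced charts of `T^*M`. -/
def IsIntegrable (g : Metric n M) (a₁ a₂ b₁ b₂ : ℝ → ℝ) : Prop :=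
  ∀ e ∈ IsManifold.maximalAtlas (𝓡 n) ∞ M, ∀ X Y : Coord n × Coord n → Coord n × Coord n,
    ContDiffOn ℝ ∞ X (inducedTarget e) → ContDiffOn ℝ ∞ Y (inducedTarget e) →
      ∀ z ∈ inducedTarget e, nijenhuis (naturalJ g a₁ a₂ b₁ b₂ e) X Y z = 0

end Chart

end CotangentBundle

end

/-! Put F = (a₁ + 2tb₁)a₁' - a₁b₁, which is `integrabilityFactor`. The Nijenhuis tensor N is
tensorial and satisfies N(JX, Y) = -J N(X, Y). The fields δ/δqⁱ and their images under J span, so it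
suffices to test N on the δ/δqⁱ (`isIntegrable_iff`). Along horizontal directions t is constant and
J⁽¹⁾ is parallel, so the mixed brackets cancel, and N(δ/δqⁱ, δ/δqʲ) is vertical with components
F(t)(pᵢ g_{jh} - pⱼ g_{ih}) - p_k R^k_{hij} (`nijenhuis_horizontalFrame`).

The curvature term is linear in p, while t runs through all positive values along each ray.
Vanishing of N therefore means that F is a constant c and that the curvature tensor has space form
shape with this c (`isIntegrable_iff_exists`). The second condition is constant sectional curvature,
because a curvature-like form is determined by its sectional curvatures (`curvatureLike_eq_zero`).

For a₁ = A/λ the equation F = c is linear in b₁, with coefficient proportional to D = λ + 2tλ', so D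
≠ 0 has to be proved. Let w = a₁ + 2tb₁. J sends the horizontal lift of the raised covector to w
times the vertical vector p, so J² = -I gives w ≠ 0 for t > 0; by continuity and w(0) = A/λ(0) > 0,
w is positive. Now F = c implies that u = A² - 2ctλ² equals A w D, hence u' = -2cλD = -(2cλ/(Aw))u.
This is a linear equation with u(0) = A² > 0, so u > 0 and D > 0 (`pos_of_integrabilityFactor_eq`).
That yields both the formula for b₁ and the final inequality. -/

noncomputable section

namespace CotangentBundle

/-! ### The metric in a chart: smoothness and positivity -/

section

variable {n : ℕ} {M : Type*} [TopologicalSpace M] [ChartedSpace (Coord n) M]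
  [IsManifold (𝓡 n) ∞ M]

/-- The section is the tangent map of `e.symm` after a constant vector field on coordinate space,
and the tangent map of a smooth map is smooth. -/
theorem contMDiffOn_coordVector {e : OpenPartialHomeomorph M (Coord n)}
    (he : e ∈ IsManifold.maximalAtlas (𝓡 n) ∞ M) (i : Fin n) :
    ContMDiffOn (𝓡 n) (𝓡 n).tangent ∞
      (fun x => (⟨e.symm x, coordVector e x i⟩ : TangentBundle (𝓡 n) M)) e.target := by
  have h1 := (contMDiffOn_symm_of_mem_maximalAtlas he).contMDiffOn_tangentMapWithin
    (m := ∞) (by simp) e.open_target.uniqueMDiffOn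
  have h2 : ContMDiff (𝓡 n) (𝓡 n).tangent ∞
      (fun x : Coord n => (⟨x, (EuclideanSpace.single i 1 : Coord n)⟩ :
        TangentBundle (𝓡 n) (Coord n))) := by
    exact contMDiff_vectorSpace_iff_contDiff
      (V := fun _ : Coord n => (EuclideanSpace.single i 1 : Coord n)).2 contDiff_const
  have h3 := h1.comp (s := e.target) h2.contMDiffOn (fun x hx => hx)
  refine h3.congr fun x hx => ?_
  simp only [Function.comp, tangentMapWithin, coordVector]
  rw [mfderivWithin_of_isOpen e.open_target hx]

theorem contDiffOn_metricMatrix (g : Metric n M) {e : OpenPartialHomeomorph M (Coord n)}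
    (he : e ∈ IsManifold.maximalAtlas (𝓡 n) ∞ M) (i j : Fin n) :
    ContDiffOn ℝ ∞ (fun x => metricMatrix g e x i j) e.target := by
  rw [← contMDiffOn_iff_contDiffOn]
  intro x hx
  have hb := (contMDiffOn_symm_of_mem_maximalAtlas he) x hx
  -- Seen as a section of the trivial line bundle, the coefficient is the smooth bilinear form `g`
  -- applied to two smooth sections.
  have : ContMDiffWithinAt (𝓡 n) ((𝓡 n).prod 𝓘(ℝ)) ∞
      (fun m ↦ Bundle.TotalSpace.mk' ℝ (E := Bundle.Trivial M ℝ) (e.symm m)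
        (g.inner (e.symm m) (coordVector e m i) (coordVector e m j))) e.target x := by
    apply ContMDiffWithinAt.clm_bundle_apply₂ (F₁ := Coord n) (F₂ := Coord n)
    · exact ContMDiffAt.comp_contMDiffWithinAt x g.contMDiff.contMDiffAt hb
    · exact contMDiffOn_coordVector he i x hx
    · exact contMDiffOn_coordVector he j x hx
  simp only [Bundle.contMDiffWithinAt_totalSpace] at this
  exact this.2

theorem metricMatrix_symm (g : Metric n M) (e : OpenPartialHomeomorph M (Coord n)) (x : Coord n)
    (i j : Fin n) : metricMatrix g e x i j = metricMatrix g e x j i :=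
  g.symm _ _ _

theorem metricForm_eq_inner (g : Metric n M) (e : OpenPartialHomeomorph M (Coord n))
    (x u v : Coord n) :
    metricForm g e x u v = g.inner (e.symm x) (mfderiv (𝓡 n) (𝓡 n) e.symm x u)
      (mfderiv (𝓡 n) (𝓡 n) e.symm x v) := by
  have h : ∀ w : Coord n, mfderiv (𝓡 n) (𝓡 n) e.symm x w = ∑ i, w i • coordVector e x i := by
    intro w
    have hw : w = ∑ i, w i • (EuclideanSpace.single i 1 : Coord n) := by
      ext k
      simp [Pi.single_apply]
    conv_lhs => rw [hw]
    exact (map_sum (mfderiv (𝓡 n) (𝓡 n) e.symm x)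
      (fun i => w i • (EuclideanSpace.single i 1 : Coord n)) Finset.univ).trans
      (Finset.sum_congr rfl fun i _ => map_smul (mfderiv (𝓡 n) (𝓡 n) e.symm x) _ _)
  rw [h u, h v]
  simp only [map_sum, map_smul, sum_apply, smul_apply,
    smul_eq_mul, metricForm, metricMatrix, Matrix.of_apply, Finset.mul_sum]
  rw [Finset.sum_comm]
  exact Finset.sum_congr rfl fun i _ => Finset.sum_congr rfl fun j _ => by ring

theorem metricForm_pos (g : Metric n M) {e : OpenPartialHomeomorph M (Coord n)}
    (he : e ∈ IsManifold.maximalAtlas (𝓡 n) ∞ M) {x : Coord n} (hx : x ∈ e.target)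
    {u : Coord n} (hu : u ≠ 0) : 0 < metricForm g e x u u := by
  rw [metricForm_eq_inner]
  apply g.pos
  intro h0
  apply hu
  -- The differential of a chart inverse is injective, so nonzero components give a nonzero tangent
  -- vector.
  have hmd : e.MDifferentiable (𝓡 n) (𝓡 n) :=
    ⟨(contMDiffOn_of_mem_maximalAtlas he).mdifferentiableOn (by simp),
      (contMDiffOn_symm_of_mem_maximalAtlas he).mdifferentiableOn (by simp)⟩
  have := hmd.symm.mfderiv_injective (x := x) hx
  exact this (h0.trans (map_zero _).symm)

end

/-! ### Directional derivatives, Christoffel symbols and curvature symmetries -/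

section

section DirectionalDerivative

variable {V : Type*} [NormedAddCommGroup V] [NormedSpace ℝ V]

/-- `f` is differentiable at `z`, with derivative `d` in the direction `w`. -/
def HasDirDeriv (f : V → ℝ) (z w : V) (d : ℝ) : Prop :=
  DifferentiableAt ℝ f z ∧ fderiv ℝ f z w = d

namespace HasDirDeriv

variable {f f₁ f₂ : V → ℝ} {z w : V} {d d₁ d₂ : ℝ}

theorem const (c : ℝ) : HasDirDeriv (fun _ => c) z w 0 :=
  ⟨differentiableAt_const c, by simp⟩

theorem add (h₁ : HasDirDeriv f₁ z w d₁) (h₂ : HasDirDeriv f₂ z w d₂) :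
    HasDirDeriv (fun y => f₁ y + f₂ y) z w (d₁ + d₂) :=
  ⟨h₁.1.add h₂.1, by rw [fderiv_fun_add h₁.1 h₂.1, add_apply, h₁.2, h₂.2]⟩

theorem mul (h₁ : HasDirDeriv f₁ z w d₁) (h₂ : HasDirDeriv f₂ z w d₂) :
    HasDirDeriv (fun y => f₁ y * f₂ y) z w (d₁ * f₂ z + f₁ z * d₂) :=
  ⟨h₁.1.mul h₂.1, by
    rw [fderiv_fun_mul h₁.1 h₂.1, add_apply, smul_apply, smul_apply, h₁.2, h₂.2, smul_eq_mul,
      smul_eq_mul]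
    ring⟩

theorem sum {ι : Type*} {s : Finset ι} {F : ι → V → ℝ} {D : ι → ℝ}
    (h : ∀ i ∈ s, HasDirDeriv (F i) z w (D i)) :
    HasDirDeriv (fun y => ∑ i ∈ s, F i y) z w (∑ i ∈ s, D i) :=
  ⟨DifferentiableAt.fun_sum fun i hi => (h i hi).1, by
    rw [fderiv_fun_sum fun i hi => (h i hi).1, sum_apply]
    exact Finset.sum_congr rfl fun i hi => (h i hi).2⟩

theorem congr_of_eventuallyEq (h : HasDirDeriv f₁ z w d) (hf : f₂ =ᶠ[nhds z] f₁) :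
    HasDirDeriv f₂ z w d :=
  ⟨h.1.congr_of_eventuallyEq hf, by rw [hf.fderiv_eq, h.2]⟩

theorem unique (h₁ : HasDirDeriv f z w d₁) (h₂ : HasDirDeriv f z w d₂) : d₁ = d₂ :=
  h₁.2.symm.trans h₂.2

/-- The coefficient functions are smooth only on [0, ∞), and the energy attains the endpoint 0 on
the zero section. Since the inner function stays nonnegative near `z`, the one-sided derivative
suffices for a two-sided chain rule. -/
theorem comp_of_nonneg {a : ℝ → ℝ} (ha : DifferentiableOn ℝ a (Ici 0))
    (hf : ∀ᶠ y in nhds z, 0 ≤ f y)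
    (h : HasDirDeriv f z w d) :
    HasDirDeriv (fun y => a (f y)) z w (derivWithin a (Ici 0) (f z) * d) := by
  have h1 := (ha (f z) hf.self_of_nhds).hasDerivWithinAt
  have h2 := h1.hasFDerivWithinAt.comp_hasFDerivAt z h.1.hasFDerivAt hf
  refine ⟨h2.differentiableAt, ?_⟩
  have h3 := h2.fderiv
  simp only [Function.comp_def] at h3
  rw [h3]
  simp [h.2, mul_comm]

end HasDirDeriv

end DirectionalDerivative

theorem hasDirDeriv_partialDeriv {n : ℕ} {f : Coord n → ℝ} {x : Coord n}
    (h : DifferentiableAt ℝ f x) (i : Fin n) :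
    HasDirDeriv f x (EuclideanSpace.single i 1) (partialDeriv i f x) :=
  ⟨h, rfl⟩

variable {n : ℕ} {M : Type*} [TopologicalSpace M] [ChartedSpace (Coord n) M]
  [IsManifold (𝓡 n) ∞ M]

theorem metricForm_eq_dotProduct (g : Metric n M) (e : OpenPartialHomeomorph M (Coord n))
    (x u v : Coord n) :
    metricForm g e x u v = dotProduct u (Matrix.mulVec (metricMatrix g e x) v) := by
  simp only [metricForm, dotProduct, Matrix.mulVec, Finset.mul_sum]
  exact Finset.sum_congr rfl fun i _ => Finset.sum_congr rfl fun j _ => by ring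

theorem det_metricMatrix_ne_zero (g : Metric n M) {e : OpenPartialHomeomorph M (Coord n)}
    (he : e ∈ IsManifold.maximalAtlas (𝓡 n) ∞ M) {x : Coord n} (hx : x ∈ e.target) :
    (metricMatrix g e x).det ≠ 0 := by
  intro h
  obtain ⟨v, hv, hv0⟩ := Matrix.exists_mulVec_eq_zero_iff.2 h
  have h1 := metricForm_pos g he hx (u := WithLp.toLp 2 v) (by simpa using hv)
  rw [metricForm_eq_dotProduct] at h1
  simp [hv0] at h1

theorem transpose_metricMatrix (g : Metric n M) (e : OpenPartialHomeomorph M (Coord n))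
    (x : Coord n) : (metricMatrix g e x).transpose = metricMatrix g e x := by
  ext i j
  exact metricMatrix_symm g e x j i

theorem transpose_inverseMetric (g : Metric n M) (e : OpenPartialHomeomorph M (Coord n))
    (x : Coord n) : (inverseMetric g e x).transpose = inverseMetric g e x := by
  rw [inverseMetric, Matrix.transpose_nonsing_inv, transpose_metricMatrix]

theorem inverseMetric_symm (g : Metric n M) (e : OpenPartialHomeomorph M (Coord n))
    (x : Coord n) (i j : Fin n) : inverseMetric g e x i j = inverseMetric g e x j i :=
  congrFun (congrFun (transpose_inverseMetric g e x) j) i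

theorem metricMatrix_mul_inverseMetric (g : Metric n M) {e : OpenPartialHomeomorph M (Coord n)}
    (he : e ∈ IsManifold.maximalAtlas (𝓡 n) ∞ M) {x : Coord n} (hx : x ∈ e.target) :
    metricMatrix g e x * inverseMetric g e x = 1 :=
  Matrix.mul_nonsing_inv _ (det_metricMatrix_ne_zero g he hx).isUnit

theorem inverseMetric_mul_metricMatrix (g : Metric n M) {e : OpenPartialHomeomorph M (Coord n)}
    (he : e ∈ IsManifold.maximalAtlas (𝓡 n) ∞ M) {x : Coord n} (hx : x ∈ e.target) :
    inverseMetric g e x * metricMatrix g e x = 1 :=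
  Matrix.nonsing_inv_mul _ (det_metricMatrix_ne_zero g he hx).isUnit

theorem contDiffOn_det {V : Type*} [NormedAddCommGroup V] [NormedSpace ℝ V] {s : Set V} {m : ℕ}
    {A : V → Matrix (Fin m) (Fin m) ℝ} (hA : ∀ i j, ContDiffOn ℝ ∞ (fun x => A x i j) s) :
    ContDiffOn ℝ ∞ (fun x => (A x).det) s := by
  simp only [Matrix.det_apply]
  exact ContDiffOn.sum fun σ _ => ContDiffOn.const_smul _ (contDiffOn_prod fun i _ => hA _ _)

theorem contDiffOn_inverseMetric (g : Metric n M) {e : OpenPartialHomeomorph M (Coord n)}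
    (he : e ∈ IsManifold.maximalAtlas (𝓡 n) ∞ M) (i j : Fin n) :
    ContDiffOn ℝ ∞ (fun x => inverseMetric g e x i j) e.target := by
  -- Cramer's rule: each entry is a quotient of determinants of matrices with smooth entries.
  have h : ∀ x, inverseMetric g e x i j
      = (metricMatrix g e x).det⁻¹ * ((metricMatrix g e x).updateRow j (Pi.single i 1)).det := by
    intro x
    rw [inverseMetric, Matrix.inv_def, Matrix.smul_apply, Matrix.adjugate_apply, smul_eq_mul,
      Ring.inverse_eq_inv']
  simp only [h]
  refine ContDiffOn.mul ?_ (contDiffOn_det fun k l => ?_)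
  · exact (contDiffOn_det fun k l => contDiffOn_metricMatrix g he k l).inv
      fun x hx => det_metricMatrix_ne_zero g he hx
  · by_cases hk : k = j
    · subst hk
      simp only [Matrix.updateRow_self]
      exact contDiffOn_const
    · simp only [Matrix.updateRow_ne hk]
      exact contDiffOn_metricMatrix g he k l

theorem contDiffOn_partialDeriv {f : Coord n → ℝ} {s : Set (Coord n)} (hs : IsOpen s)
    (hf : ContDiffOn ℝ ∞ f s) (i : Fin n) : ContDiffOn ℝ ∞ (partialDeriv i f) s :=
  (hf.fderiv_of_isOpen hs (m := ∞) (by simp)).clm_apply contDiffOn_const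

theorem contDiffOn_christoffel (g : Metric n M) {e : OpenPartialHomeomorph M (Coord n)}
    (he : e ∈ IsManifold.maximalAtlas (𝓡 n) ∞ M) (k i j : Fin n) :
    ContDiffOn ℝ ∞ (christoffel g e k i j) e.target := by
  have h := fun a b c => contDiffOn_partialDeriv e.open_target (contDiffOn_metricMatrix g he a b) c
  refine contDiffOn_const.mul (ContDiffOn.sum fun l _ => ?_)
  exact (contDiffOn_inverseMetric g he k l).mul (((h j l i).add (h i l j)).sub (h i j l))

theorem christoffel_symm (g : Metric n M) (e : OpenPartialHomeomorph M (Coord n))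
    (k i j : Fin n) : christoffel g e k i j = christoffel g e k j i := by
  have h : (fun y => metricMatrix g e y i j) = fun y => metricMatrix g e y j i :=
    funext fun y => metricMatrix_symm g e y i j
  funext x
  unfold christoffel
  rw [h]
  congr 1
  exact Finset.sum_congr rfl fun l _ => by ring

/-- The matrix `(Γ^m_{ik})` with row index `m` and column index `k`. -/
def christoffelMatrix (g : Metric n M) (e : OpenPartialHomeomorph M (Coord n)) (x : Coord n)
    (i : Fin n) : Matrix (Fin n) (Fin n) ℝ :=
  Matrix.of fun m k => christoffel g e m i k x

/-- The matrix `(∂ᵢ Γ^m_{jk})` with row index `m` and column index `k`. -/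
def derivChristoffelMatrix (g : Metric n M) (e : OpenPartialHomeomorph M (Coord n)) (x : Coord n)
    (i j : Fin n) : Matrix (Fin n) (Fin n) ℝ :=
  Matrix.of fun m k => partialDeriv i (christoffel g e m j k) x

/-- The matrix `(∂ᵢ g_{kl})`. -/
def derivMetricMatrix (g : Metric n M) (e : OpenPartialHomeomorph M (Coord n)) (x : Coord n)
    (i : Fin n) : Matrix (Fin n) (Fin n) ℝ :=
  Matrix.of fun k l => partialDeriv i (fun y => metricMatrix g e y k l) x

/-- The matrix `(R^h_{kij})` with row index `h` and column index `k`. -/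
def curvatureMatrix (g : Metric n M) (e : OpenPartialHomeomorph M (Coord n)) (x : Coord n)
    (i j : Fin n) : Matrix (Fin n) (Fin n) ℝ :=
  Matrix.of fun h k => curvature g e h k i j x

theorem curvatureMatrix_eq (g : Metric n M) (e : OpenPartialHomeomorph M (Coord n)) (x : Coord n)
    (i j : Fin n) :
    curvatureMatrix g e x i j = derivChristoffelMatrix g e x i j - derivChristoffelMatrix g e x j i
      + (christoffelMatrix g e x i * christoffelMatrix g e x j
        - christoffelMatrix g e x j * christoffelMatrix g e x i) := by
  ext h k
  simp [curvatureMatrix, derivChristoffelMatrix, christoffelMatrix, curvature, Matrix.mul_apply]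

/-- Lowering the upper index cancels the inverse metric and leaves the Christoffel symbols of the
first kind. Adding the transpose then gives metric compatibility. -/
theorem metricMatrix_mul_christoffelMatrix (g : Metric n M)
    {e : OpenPartialHomeomorph M (Coord n)} (he : e ∈ IsManifold.maximalAtlas (𝓡 n) ∞ M)
    {x : Coord n} (hx : x ∈ e.target) (i m j : Fin n) :
    (metricMatrix g e x * christoffelMatrix g e x i) m j =
      1 / 2 * (derivMetricMatrix g e x i j m + derivMetricMatrix g e x j i m
        - derivMetricMatrix g e x m i j) := by
  set S : Fin n → ℝ := fun l => 1 / 2 * (derivMetricMatrix g e x i j l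
    + derivMetricMatrix g e x j i l - derivMetricMatrix g e x l i j) with hS
  have h1 : ∀ k, christoffelMatrix g e x i k j = (Matrix.mulVec (inverseMetric g e x) S) k := by
    intro k
    simp only [christoffelMatrix, christoffel, Matrix.of_apply, Matrix.mulVec, dotProduct, hS,
      derivMetricMatrix, Finset.mul_sum]
    exact Finset.sum_congr rfl fun l _ => by ring
  have h2 : (metricMatrix g e x * christoffelMatrix g e x i) m j
      = (Matrix.mulVec (metricMatrix g e x) (Matrix.mulVec (inverseMetric g e x) S)) m := by
    simp only [Matrix.mul_apply, h1]
    rfl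
  rw [h2, Matrix.mulVec_mulVec, metricMatrix_mul_inverseMetric g he hx, Matrix.one_mulVec]

theorem derivMetricMatrix_symm (g : Metric n M) (e : OpenPartialHomeomorph M (Coord n))
    (x : Coord n) (i k l : Fin n) :
    derivMetricMatrix g e x i k l = derivMetricMatrix g e x i l k := by
  have h : (fun y => metricMatrix g e y k l) = fun y => metricMatrix g e y l k :=
    funext fun y => metricMatrix_symm g e y k l
  simp [derivMetricMatrix, h]

/-- The Levi-Civita connection is compatible with the metric. -/
theorem derivMetricMatrix_eq (g : Metric n M)
    {e : OpenPartialHomeomorph M (Coord n)} (he : e ∈ IsManifold.maximalAtlas (𝓡 n) ∞ M)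
    {x : Coord n} (hx : x ∈ e.target) (i : Fin n) :
    derivMetricMatrix g e x i = (christoffelMatrix g e x i).transpose * metricMatrix g e x
      + metricMatrix g e x * christoffelMatrix g e x i := by
  have h : (christoffelMatrix g e x i).transpose * metricMatrix g e x
      = (metricMatrix g e x * christoffelMatrix g e x i).transpose := by
    rw [Matrix.transpose_mul, transpose_metricMatrix]
  rw [h]
  ext k l
  rw [Matrix.add_apply, Matrix.transpose_apply, metricMatrix_mul_christoffelMatrix g he hx,
    metricMatrix_mul_christoffelMatrix g he hx, derivMetricMatrix_symm g e x i k l,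
    derivMetricMatrix_symm g e x l i k, derivMetricMatrix_symm g e x k i l]
  ring

theorem differentiableAt_of_contDiffOn {V : Type*} [NormedAddCommGroup V]
    [NormedSpace ℝ V] {f : V → ℝ} {s : Set V} (hf : ContDiffOn ℝ ∞ f s) (hs : IsOpen s) {x : V}
    (hx : x ∈ s) : DifferentiableAt ℝ f x :=
  (hf.contDiffAt (hs.mem_nhds hx)).differentiableAt (by simp)

theorem partialDeriv_comm {f : Coord n → ℝ} {x : Coord n} (hf : ContDiffAt ℝ ∞ f x)
    (i j : Fin n) : partialDeriv i (partialDeriv j f) x = partialDeriv j (partialDeriv i f) x := by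
  have h1 : DifferentiableAt ℝ (fderiv ℝ f) x :=
    (hf.fderiv_right (m := ∞) (by simp)).differentiableAt (by simp)
  have h2 : ∀ k l, partialDeriv k (partialDeriv l f) x
      = fderiv ℝ (fderiv ℝ f) x (EuclideanSpace.single k 1) (EuclideanSpace.single l 1) := by
    intro k l
    have h3 := h1.hasFDerivAt.clm_apply (hasFDerivAt_const (EuclideanSpace.single l (1 : ℝ)) x)
    unfold partialDeriv
    rw [h3.fderiv]
    simp
  rw [h2, h2]
  exact hf.isSymmSndFDerivAt (by simpa using ENat.LEInfty.out) _ _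

/-- The curvature operators `R(∂ᵢ, ∂ⱼ)` are skew-adjoint with respect to the metric. -/
theorem curvatureMatrix_skew (g : Metric n M)
    {e : OpenPartialHomeomorph M (Coord n)} (he : e ∈ IsManifold.maximalAtlas (𝓡 n) ∞ M)
    {x : Coord n} (hx : x ∈ e.target) (i j : Fin n) :
    (curvatureMatrix g e x i j).transpose * metricMatrix g e x
      + metricMatrix g e x * curvatureMatrix g e x i j = 0 := by
  -- Compatibility ∂ⱼG = ΓⱼᵀG + GΓⱼ is differentiated once more. Antisymmetrising in i, j kills the
  -- second derivatives of G, and the rest is the claim.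
  have key : ∀ i j, (Matrix.of fun k l => partialDeriv i (partialDeriv j
        (fun y => metricMatrix g e y k l)) x)
      = ((derivChristoffelMatrix g e x i j).transpose * metricMatrix g e x
        + (christoffelMatrix g e x j).transpose * derivMetricMatrix g e x i)
        + (derivMetricMatrix g e x i * christoffelMatrix g e x j
        + metricMatrix g e x * derivChristoffelMatrix g e x i j) := by
    intro i j
    ext k l
    have hG : ∀ a b, HasDirDeriv (fun y => metricMatrix g e y a b) x (EuclideanSpace.single i 1)
        (derivMetricMatrix g e x i a b) := fun a b =>
      hasDirDeriv_partialDeriv (differentiableAt_of_contDiffOn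
        (contDiffOn_metricMatrix g he a b) e.open_target hx) i
    have hC : ∀ a b, HasDirDeriv (fun y => christoffelMatrix g e y j a b) x
        (EuclideanSpace.single i 1) (derivChristoffelMatrix g e x i j a b) := fun a b =>
      hasDirDeriv_partialDeriv (differentiableAt_of_contDiffOn
        (contDiffOn_christoffel g he a j b) e.open_target hx) i
    have h1 := (HasDirDeriv.sum (s := Finset.univ) fun m _ => (hC m k).mul (hG m l)).add
      (HasDirDeriv.sum (s := Finset.univ) fun m _ => (hG k m).mul (hC m l))
    have h2 : partialDeriv j (fun y => metricMatrix g e y k l) =ᶠ[nhds x] fun y =>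
        (∑ m, christoffelMatrix g e y j m k * metricMatrix g e y m l)
          + ∑ m, metricMatrix g e y k m * christoffelMatrix g e y j m l := by
      filter_upwards [e.open_target.mem_nhds hx] with y hy
      have := congrFun (congrFun (derivMetricMatrix_eq g he hy j) k) l
      simpa [derivMetricMatrix, Matrix.mul_apply] using this
    have h3 := (h1.congr_of_eventuallyEq h2).2
    simp only [Matrix.of_apply, Matrix.add_apply, Matrix.mul_apply, Matrix.transpose_apply,
      ← Finset.sum_add_distrib] at h3 ⊢
    exact h3
  have hsymm : (Matrix.of fun k l => partialDeriv i (partialDeriv j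
        (fun y => metricMatrix g e y k l)) x)
      = (Matrix.of fun k l => partialDeriv j (partialDeriv i
        (fun y => metricMatrix g e y k l)) x) := by
    ext k l
    exact partialDeriv_comm ((contDiffOn_metricMatrix g he k l).contDiffAt
      (e.open_target.mem_nhds hx)) i j
  rw [key, key, derivMetricMatrix_eq g he hx, derivMetricMatrix_eq g he hx] at hsymm
  rw [curvatureMatrix_eq]
  simp only [Matrix.transpose_add, Matrix.transpose_sub, Matrix.transpose_mul]
  rw [← sub_eq_zero] at hsymm
  rw [← hsymm]
  noncomm_ring

theorem curvature_swap (g : Metric n M) (e : OpenPartialHomeomorph M (Coord n)) (h k i j : Fin n)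
    (x : Coord n) : curvature g e h k i j x = -curvature g e h k j i x := by
  simp only [curvature, neg_add, neg_sub, ← Finset.sum_neg_distrib]

/-- The connection is torsion free: once the lower indices of the Christoffel symbols are put in a
common order, all terms cancel in pairs. -/
theorem curvature_bianchi (g : Metric n M) (e : OpenPartialHomeomorph M (Coord n))
    (h k i j : Fin n) (x : Coord n) :
    curvature g e h k i j x + curvature g e h i j k x + curvature g e h j k i x = 0 := by
  simp only [curvature, christoffel_symm g e _ j i, christoffel_symm g e _ k i,
    christoffel_symm g e _ k j, Finset.sum_sub_distrib]
  ring

end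

/-! ### Derivatives of the energy and of J⁽¹⁾ along the adapted frame -/

section

theorem HasDirDeriv.comp_fst {V W : Type*} [NormedAddCommGroup V] [NormedSpace ℝ V]
    [NormedAddCommGroup W] [NormedSpace ℝ W] {f : V → ℝ} {z w : V × W} {d : ℝ}
    (h : HasDirDeriv f z.1 w.1 d) : HasDirDeriv (fun y : V × W => f y.1) z w d := by
  have h1 : HasFDerivAt (fun y : V × W => f y.1)
      ((fderiv ℝ f z.1).comp (ContinuousLinearMap.fst ℝ V W)) z :=
    h.1.hasFDerivAt.comp z hasFDerivAt_fst
  exact ⟨h1.differentiableAt, by rw [h1.fderiv]; exact h.2⟩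

theorem HasDirDeriv.snd_apply {n : ℕ} (z w : Coord n × Coord n) (k : Fin n) :
    HasDirDeriv (fun y : Coord n × Coord n => y.2 k) z w (w.2 k) := by
  have h1 : HasFDerivAt (fun y : Coord n × Coord n => y.2 k) (dp k) z := (dp k).hasFDerivAt
  exact ⟨h1.differentiableAt, by rw [h1.fderiv]; rfl⟩

theorem HasDirDeriv.fst_horizontal {n : ℕ} {f : Coord n → ℝ} {z w : Coord n × Coord n}
    (h : DifferentiableAt ℝ f z.1) {i : Fin n} (hw : w.1 = EuclideanSpace.single i 1) :
    HasDirDeriv (fun y : Coord n × Coord n => f y.1) z w (partialDeriv i f z.1) :=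
  HasDirDeriv.comp_fst ⟨h, by rw [hw]; rfl⟩

theorem HasDirDeriv.fst_vertical {n : ℕ} {f : Coord n → ℝ} {z w : Coord n × Coord n}
    (h : DifferentiableAt ℝ f z.1) (hw : w.1 = 0) :
    HasDirDeriv (fun y : Coord n × Coord n => f y.1) z w 0 :=
  HasDirDeriv.comp_fst ⟨h, by rw [hw, map_zero]⟩

theorem isOpen_inducedTarget {n : ℕ} {M : Type*} [TopologicalSpace M]
    (e : OpenPartialHomeomorph M (Coord n)) : IsOpen (inducedTarget e) :=
  e.open_target.prod isOpen_univ

variable {n : ℕ} {M : Type*} [TopologicalSpace M] [ChartedSpace (Coord n) M]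
  [IsManifold (𝓡 n) ∞ M]

/-- Differentiating G⁻¹G = 1 gives ∂G⁻¹ = -G⁻¹(∂G)G⁻¹; metric compatibility then says that the
inverse metric is parallel too. -/
theorem partialDeriv_inverseMetric (g : Metric n M)
    {e : OpenPartialHomeomorph M (Coord n)} (he : e ∈ IsManifold.maximalAtlas (𝓡 n) ∞ M)
    {x : Coord n} (hx : x ∈ e.target) (i k l : Fin n) :
    partialDeriv i (fun y => inverseMetric g e y k l) x
      = (-(inverseMetric g e x * (christoffelMatrix g e x i).transpose
        + christoffelMatrix g e x i * inverseMetric g e x)) k l := by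
  set D : Matrix (Fin n) (Fin n) ℝ :=
    Matrix.of fun k l => partialDeriv i (fun y => inverseMetric g e y k l) x with hD
  have hI : ∀ a b, HasDirDeriv (fun y => inverseMetric g e y a b) x (EuclideanSpace.single i 1)
      (D a b) := fun a b => hasDirDeriv_partialDeriv
    (differentiableAt_of_contDiffOn (contDiffOn_inverseMetric g he a b) e.open_target hx) i
  have hG : ∀ a b, HasDirDeriv (fun y => metricMatrix g e y a b) x (EuclideanSpace.single i 1)
      (derivMetricMatrix g e x i a b) := fun a b => hasDirDeriv_partialDeriv
    (differentiableAt_of_contDiffOn (contDiffOn_metricMatrix g he a b) e.open_target hx) i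
  have h0 : D * metricMatrix g e x + inverseMetric g e x * derivMetricMatrix g e x i = 0 := by
    ext a b
    have h1 := HasDirDeriv.sum (s := Finset.univ) fun m _ => (hI a m).mul (hG m b)
    have h2 : HasDirDeriv (fun y => ∑ m, inverseMetric g e y a m * metricMatrix g e y m b) x
        (EuclideanSpace.single i 1) 0 := by
      refine (HasDirDeriv.const ((1 : Matrix (Fin n) (Fin n) ℝ) a b)).congr_of_eventuallyEq ?_
      filter_upwards [e.open_target.mem_nhds hx] with y hy
      rw [← inverseMetric_mul_metricMatrix g he hy, Matrix.mul_apply]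
    simpa [Matrix.mul_apply, Finset.sum_add_distrib] using h1.unique h2
  have h3 : D = -(inverseMetric g e x * derivMetricMatrix g e x i * inverseMetric g e x) := by
    calc D = D * (metricMatrix g e x * inverseMetric g e x) := by
          rw [metricMatrix_mul_inverseMetric g he hx, mul_one]
      _ = (D * metricMatrix g e x) * inverseMetric g e x := by rw [mul_assoc]
      _ = _ := by rw [eq_neg_of_add_eq_zero_left h0, neg_mul]
  have h4 : D = -(inverseMetric g e x * (christoffelMatrix g e x i).transpose
        + christoffelMatrix g e x i * inverseMetric g e x) := by
    rw [h3, derivMetricMatrix_eq g he hx, mul_add, add_mul, mul_assoc, mul_assoc,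
      metricMatrix_mul_inverseMetric g he hx, mul_one, ← mul_assoc _ (metricMatrix g e x),
      inverseMetric_mul_metricMatrix g he hx, one_mul]
  rw [← h4]
  rfl

/-- The energy is half the squared length of the raised covector, so its sign follows from
positivity of the metric. -/
theorem energy_eq_metricForm (g : Metric n M) {e : OpenPartialHomeomorph M (Coord n)}
    (he : e ∈ IsManifold.maximalAtlas (𝓡 n) ∞ M) {z : Coord n × Coord n}
    (hz : z ∈ inducedTarget e) :
    energy g e z = 1 / 2 * metricForm g e z.1
      (WithLp.toLp 2 (Matrix.mulVec (inverseMetric g e z.1) z.2))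
      (WithLp.toLp 2 (Matrix.mulVec (inverseMetric g e z.1) z.2)) := by
  rw [metricForm_eq_dotProduct]
  simp only
  rw [Matrix.mulVec_mulVec, metricMatrix_mul_inverseMetric g he hz.1, Matrix.one_mulVec, energy]
  simp only [dotProduct, Matrix.mulVec, Finset.sum_mul]
  congr 1
  exact Finset.sum_congr rfl fun i _ => Finset.sum_congr rfl fun j _ => by ring

theorem energy_pos (g : Metric n M) {e : OpenPartialHomeomorph M (Coord n)}
    (he : e ∈ IsManifold.maximalAtlas (𝓡 n) ∞ M) {z : Coord n × Coord n}
    (hz : z ∈ inducedTarget e) (hp : z.2 ≠ 0) : 0 < energy g e z := by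
  rw [energy_eq_metricForm g he hz]
  refine mul_pos (by norm_num) (metricForm_pos g he hz.1 fun h => hp ?_)
  have h0 : Matrix.mulVec (inverseMetric g e z.1) z.2 = 0 := congrArg WithLp.ofLp h
  have h1 := congrArg (Matrix.mulVec (metricMatrix g e z.1)) h0
  rw [Matrix.mulVec_mulVec, metricMatrix_mul_inverseMetric g he hz.1, Matrix.one_mulVec,
    Matrix.mulVec_zero] at h1
  ext i
  exact congrFun h1 i

theorem energy_smul (g : Metric n M) (e : OpenPartialHomeomorph M (Coord n)) (x p : Coord n)
    (s : ℝ) : energy g e (x, s • p) = s ^ 2 * energy g e (x, p) := by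
  simp only [energy, PiLp.smul_apply, smul_eq_mul, Finset.mul_sum]
  exact Finset.sum_congr rfl fun i _ => Finset.sum_congr rfl fun j _ => by ring

theorem energy_nonneg (g : Metric n M) {e : OpenPartialHomeomorph M (Coord n)}
    (he : e ∈ IsManifold.maximalAtlas (𝓡 n) ∞ M) {z : Coord n × Coord n}
    (hz : z ∈ inducedTarget e) : 0 ≤ energy g e z := by
  by_cases h : z.2 = 0
  · have := energy_smul g e z.1 0 0
    rw [zero_smul, ← h] at this
    rw [show z = (z.1, z.2) from rfl, this]
    simp
  · exact (energy_pos g he hz h).le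

theorem raised_eq (g : Metric n M) (e : OpenPartialHomeomorph M (Coord n))
    (z : Coord n × Coord n) :
    raised g e z = Matrix.vecMul z.2 (inverseMetric g e z.1) := rfl

theorem christoffelZero_eq (g : Metric n M) (e : OpenPartialHomeomorph M (Coord n))
    (z : Coord n × Coord n) (i : Fin n) :
    christoffelZero g e z i = Matrix.vecMul z.2 (christoffelMatrix g e z.1 i) := rfl

/-- Keeping the derivative `D` of the inverse metric abstract serves the horizontal and the vertical
case at once. By symmetry the two terms that differentiate a factor p agree, which absorbs the 1/2.
-/
theorem hasDirDeriv_energy {g : Metric n M} {e : OpenPartialHomeomorph M (Coord n)}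
    {z w : Coord n × Coord n} {D : Matrix (Fin n) (Fin n) ℝ}
    (hD : ∀ a b, HasDirDeriv (fun y : Coord n × Coord n => inverseMetric g e y.1 a b) z w (D a b)) :
    HasDirDeriv (energy g e) z w
      (1 / 2 * dotProduct z.2 (Matrix.mulVec D z.2) + dotProduct (raised g e z) w.2) := by
  have h1 := (HasDirDeriv.const (z := z) (w := w) (1 / 2 : ℝ)).mul
    (HasDirDeriv.sum (s := Finset.univ) fun i _ => HasDirDeriv.sum (s := Finset.univ) fun k _ =>
      ((hD i k).mul (HasDirDeriv.snd_apply z w i)).mul (HasDirDeriv.snd_apply z w k))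
  refine ⟨h1.1, h1.2.trans ?_⟩
  have e1 : dotProduct z.2 (Matrix.mulVec D z.2) = ∑ i, ∑ k, D i k * z.2 i * z.2 k := by
    simp only [dotProduct, Matrix.mulVec, Finset.mul_sum]
    exact Finset.sum_congr rfl fun i _ => Finset.sum_congr rfl fun j _ => by ring
  have e2 : dotProduct (raised g e z) w.2
      = ∑ i, ∑ k, inverseMetric g e z.1 i k * w.2 i * z.2 k := by
    simp only [dotProduct, raised, Finset.sum_mul]
    refine Finset.sum_congr rfl fun i _ => Finset.sum_congr rfl fun j _ => ?_
    rw [inverseMetric_symm]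
    ring
  have e3 : dotProduct (raised g e z) w.2
      = ∑ i, ∑ k, inverseMetric g e z.1 i k * z.2 i * w.2 k := by
    simp only [dotProduct, raised, Finset.sum_mul]
    rw [Finset.sum_comm]
    exact Finset.sum_congr rfl fun i _ => Finset.sum_congr rfl fun j _ => by ring
  have e4 : dotProduct (raised g e z) w.2 = 1 / 2 * dotProduct (raised g e z) w.2
      + 1 / 2 * dotProduct (raised g e z) w.2 := by ring
  rw [e4]
  nth_rewrite 1 [e2]
  rw [e3, e1, zero_mul, zero_add, ← mul_add, ← mul_add, ← Finset.sum_add_distrib,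
    ← Finset.sum_add_distrib]
  congr 1
  refine Finset.sum_congr rfl fun i _ => ?_
  rw [← Finset.sum_add_distrib, ← Finset.sum_add_distrib]
  exact Finset.sum_congr rfl fun i _ => by ring

/-- The energy density is constant along horizontal directions. -/
theorem hasDirDeriv_energy_horizontal (g : Metric n M) {e : OpenPartialHomeomorph M (Coord n)}
    (he : e ∈ IsManifold.maximalAtlas (𝓡 n) ∞ M) {z w : Coord n × Coord n}
    (hz : z ∈ inducedTarget e) {i : Fin n} (hw₁ : w.1 = EuclideanSpace.single i 1)
    (hw₂ : ⇑w.2 = christoffelZero g e z i) :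
    HasDirDeriv (energy g e) z w 0 := by
  have h := hasDirDeriv_energy (g := g) (e := e) (z := z) (w := w)
    (D := -(inverseMetric g e z.1 * (christoffelMatrix g e z.1 i).transpose
        + christoffelMatrix g e z.1 i * inverseMetric g e z.1)) (fun a b => by
      rw [← partialDeriv_inverseMetric g he hz.1]
      exact HasDirDeriv.fst_horizontal (differentiableAt_of_contDiffOn
        (contDiffOn_inverseMetric g he a b) e.open_target hz.1) hw₁)
  refine ⟨h.1, h.2.trans ?_⟩
  rw [hw₂, christoffelZero_eq, raised_eq, Matrix.neg_mulVec, Matrix.add_mulVec,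
    ← Matrix.mulVec_mulVec, ← Matrix.mulVec_mulVec, Matrix.mulVec_transpose,
    dotProduct_neg, dotProduct_add, Matrix.dotProduct_mulVec,
    Matrix.dotProduct_mulVec _ (christoffelMatrix g e z.1 i)]
  -- Both halves of the derivative of the inverse metric contribute the same amount, and together
  -- they cancel the term from moving p.
  have : dotProduct (Matrix.vecMul z.2 (christoffelMatrix g e z.1 i))
        (Matrix.mulVec (inverseMetric g e z.1) z.2)
      = dotProduct (Matrix.vecMul z.2 (inverseMetric g e z.1))
        (Matrix.vecMul z.2 (christoffelMatrix g e z.1 i)) := by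
    rw [dotProduct_comm]
    congr 1
    rw [← Matrix.vecMul_transpose, transpose_inverseMetric]
  rw [this]
  ring

theorem hasDirDeriv_energy_vertical (g : Metric n M) {e : OpenPartialHomeomorph M (Coord n)}
    (he : e ∈ IsManifold.maximalAtlas (𝓡 n) ∞ M) {z w : Coord n × Coord n}
    (hz : z ∈ inducedTarget e) (hw₁ : w.1 = 0) :
    HasDirDeriv (energy g e) z w (dotProduct (raised g e z) w.2) := by
  have h := hasDirDeriv_energy (g := g) (e := e) (z := z) (w := w) (D := 0) (fun a b =>
      HasDirDeriv.fst_vertical (differentiableAt_of_contDiffOn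
        (contDiffOn_inverseMetric g he a b) e.open_target hz.1) hw₁)
  refine ⟨h.1, h.2.trans ?_⟩
  simp

theorem hasDirDeriv_lowerCoeff {g : Metric n M} {e : OpenPartialHomeomorph M (Coord n)}
    (he : e ∈ IsManifold.maximalAtlas (𝓡 n) ∞ M) {a b : ℝ → ℝ}
    (ha : DifferentiableOn ℝ a (Ici 0)) (hb : DifferentiableOn ℝ b (Ici 0))
    {z w : Coord n × Coord n} (hz : z ∈ inducedTarget e) {τ d : ℝ} {i j : Fin n}
    (hE : HasDirDeriv (energy g e) z w τ)
    (hD : HasDirDeriv (fun y : Coord n × Coord n => metricMatrix g e y.1 i j) z w d) :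
    HasDirDeriv (fun y => lowerCoeff g a b e y i j) z w
      (derivWithin a (Ici 0) (energy g e z) * τ * metricMatrix g e z.1 i j
        + a (energy g e z) * d
        + ((derivWithin b (Ici 0) (energy g e z) * τ * z.2 i + b (energy g e z) * w.2 i) * z.2 j
          + b (energy g e z) * z.2 i * w.2 j)) := by
  have hpos : ∀ᶠ y in nhds z, 0 ≤ energy g e y := by
    filter_upwards [(isOpen_inducedTarget e).mem_nhds hz] with y hy using energy_nonneg g he hy
  exact ((hE.comp_of_nonneg ha hpos).mul hD).add
    (((hE.comp_of_nonneg hb hpos).mul (HasDirDeriv.snd_apply z w i)).mul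
      (HasDirDeriv.snd_apply z w j))

/-- The tensor `J⁽¹⁾` is parallel along horizontal directions. -/
theorem hasDirDeriv_lowerCoeff_horizontal (g : Metric n M)
    {e : OpenPartialHomeomorph M (Coord n)} (he : e ∈ IsManifold.maximalAtlas (𝓡 n) ∞ M)
    {a b : ℝ → ℝ} (ha : DifferentiableOn ℝ a (Ici 0)) (hb : DifferentiableOn ℝ b (Ici 0))
    {z w : Coord n × Coord n} (hz : z ∈ inducedTarget e) {k : Fin n}
    (hw₁ : w.1 = EuclideanSpace.single k 1) (hw₂ : ⇑w.2 = christoffelZero g e z k)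
    (i j : Fin n) :
    HasDirDeriv (fun y => lowerCoeff g a b e y i j) z w
      (∑ l, christoffel g e l k i z.1 * lowerCoeff g a b e z l j
        + ∑ l, lowerCoeff g a b e z i l * christoffel g e l k j z.1) := by
  have h := hasDirDeriv_lowerCoeff he ha hb hz (hasDirDeriv_energy_horizontal g he hz hw₁ hw₂)
    (HasDirDeriv.fst_horizontal (differentiableAt_of_contDiffOn
      (contDiffOn_metricMatrix g he i j) e.open_target hz.1) hw₁)
  refine ⟨h.1, h.2.trans ?_⟩
  have h1 : partialDeriv k (fun y => metricMatrix g e y i j) z.1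
      = ∑ l, christoffel g e l k i z.1 * metricMatrix g e z.1 l j
        + ∑ l, metricMatrix g e z.1 i l * christoffel g e l k j z.1 := by
    have := congrFun (congrFun (derivMetricMatrix_eq g he hz.1 k) i) j
    simpa [derivMetricMatrix, christoffelMatrix, Matrix.mul_apply] using this
  rw [h1, hw₂]
  simp only [lowerCoeff, christoffelZero, mul_add, add_mul, Finset.sum_add_distrib,
    Finset.mul_sum, Finset.sum_mul]
  have e1 : ∀ l, christoffel g e l k i z.1 * (a (energy g e z) * metricMatrix g e z.1 l j)
      = a (energy g e z) * (christoffel g e l k i z.1 * metricMatrix g e z.1 l j) :=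
    fun l => by ring
  have e2 : ∀ l, a (energy g e z) * metricMatrix g e z.1 i l * christoffel g e l k j z.1
      = a (energy g e z) * (metricMatrix g e z.1 i l * christoffel g e l k j z.1) :=
    fun l => by ring
  have e3 : ∀ l, christoffel g e l k i z.1 * (b (energy g e z) * z.2 l * z.2 j)
      = b (energy g e z) * (z.2 l * christoffel g e l k i z.1) * z.2 j := fun l => by ring
  have e4 : ∀ l, b (energy g e z) * z.2 i * z.2 l * christoffel g e l k j z.1
      = b (energy g e z) * z.2 i * (z.2 l * christoffel g e l k j z.1) := fun l => by ring
  simp only [e1, e2, e3, e4]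
  ring

/-- The vertical derivatives of `J⁽¹⁾`. -/
theorem hasDirDeriv_lowerCoeff_vertical (g : Metric n M)
    {e : OpenPartialHomeomorph M (Coord n)} (he : e ∈ IsManifold.maximalAtlas (𝓡 n) ∞ M)
    {a b : ℝ → ℝ} (ha : DifferentiableOn ℝ a (Ici 0)) (hb : DifferentiableOn ℝ b (Ici 0))
    {z w : Coord n × Coord n} (hz : z ∈ inducedTarget e) (hw₁ : w.1 = 0) (i j : Fin n) :
    HasDirDeriv (fun y => lowerCoeff g a b e y i j) z w
      (derivWithin a (Ici 0) (energy g e z) * dotProduct (raised g e z) w.2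
          * metricMatrix g e z.1 i j
        + ((derivWithin b (Ici 0) (energy g e z) * dotProduct (raised g e z) w.2 * z.2 i
          + b (energy g e z) * w.2 i) * z.2 j + b (energy g e z) * z.2 i * w.2 j)) := by
  have h := hasDirDeriv_lowerCoeff he ha hb hz (hasDirDeriv_energy_vertical g he hz hw₁)
    (HasDirDeriv.fst_vertical (differentiableAt_of_contDiffOn
      (contDiffOn_metricMatrix g he i j) e.open_target hz.1) hw₁)
  refine ⟨h.1, h.2.trans ?_⟩
  ring

theorem hasDirDeriv_christoffelZero_horizontal (g : Metric n M)
    {e : OpenPartialHomeomorph M (Coord n)} (he : e ∈ IsManifold.maximalAtlas (𝓡 n) ∞ M)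
    {z w : Coord n × Coord n} (hz : z ∈ inducedTarget e) {k : Fin n}
    (hw₁ : w.1 = EuclideanSpace.single k 1) (i j : Fin n) :
    HasDirDeriv (fun y => christoffelZero g e y i j) z w
      (∑ l, (w.2 l * christoffel g e l i j z.1
        + z.2 l * partialDeriv k (christoffel g e l i j) z.1)) :=
  HasDirDeriv.sum fun l _ => (HasDirDeriv.snd_apply z w l).mul
    (HasDirDeriv.fst_horizontal (differentiableAt_of_contDiffOn
      (contDiffOn_christoffel g he l i j) e.open_target hz.1) hw₁)

theorem hasDirDeriv_christoffelZero_vertical (g : Metric n M)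
    {e : OpenPartialHomeomorph M (Coord n)} (he : e ∈ IsManifold.maximalAtlas (𝓡 n) ∞ M)
    {z w : Coord n × Coord n} (hz : z ∈ inducedTarget e) (hw₁ : w.1 = 0) (i j : Fin n) :
    HasDirDeriv (fun y => christoffelZero g e y i j) z w
      (∑ l, w.2 l * christoffel g e l i j z.1) := by
  have h := HasDirDeriv.sum (s := Finset.univ) fun l _ => (HasDirDeriv.snd_apply z w l).mul
    (HasDirDeriv.fst_vertical (differentiableAt_of_contDiffOn
      (contDiffOn_christoffel g he l i j) e.open_target hz.1) hw₁)
  refine ⟨h.1, h.2.trans ?_⟩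
  simp

end

/-! ### Tensoriality of the Nijenhuis tensor and its values on the horizontal frame -/

section

section Tensoriality

variable {V : Type*} [NormedAddCommGroup V] [NormedSpace ℝ V]

/-- The value of the Nijenhuis tensor of `J` at `z` on the vectors `x`, `y`. -/
def nijenhuisTensor (J : V → V →L[ℝ] V) (z x y : V) : V :=
  fderiv ℝ J z (J z x) y - fderiv ℝ J z (J z y) x + J z (fderiv ℝ J z y x)
    - J z (fderiv ℝ J z x y)

/-- The derivatives of X and Y cancel because J² = -I at `z`. Fields may thus be replaced by any
others with the same values at `z`. -/
theorem nijenhuis_eq_nijenhuisTensor {J : V → V →L[ℝ] V} {X Y : V → V} {z : V}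
    (hJ : DifferentiableAt ℝ J z) (hJ2 : ∀ w, J z (J z w) = -w)
    (hX : DifferentiableAt ℝ X z) (hY : DifferentiableAt ℝ Y z) :
    nijenhuis J X Y z = nijenhuisTensor J z (X z) (Y z) := by
  have h : ∀ {Z : V → V}, DifferentiableAt ℝ Z z → ∀ w,
      fderiv ℝ (fun y => J y (Z y)) z w = J z (fderiv ℝ Z z w) + fderiv ℝ J z w (Z z) := by
    intro Z hZ w
    rw [(hJ.hasFDerivAt.clm_apply hZ.hasFDerivAt).fderiv]
    simp
  simp only [nijenhuis, VectorField.lieBracket, h hX, h hY, map_sub, map_add, hJ2,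
    nijenhuisTensor]
  abel

/-- This is the derivative of J² = -I, which is why that identity is needed on a neighbourhood of
`z`. -/
theorem fderiv_anticomm {J : V → V →L[ℝ] V} {z : V} (hJ : DifferentiableAt ℝ J z)
    (hJ2 : ∀ᶠ y in nhds z, ∀ w, J y (J y w) = -w) (v w : V) :
    fderiv ℝ J z v (J z w) = -J z (fderiv ℝ J z v w) := by
  have hw := hJ.hasFDerivAt.clm_apply (hasFDerivAt_const w z)
  have h1 := hJ.hasFDerivAt.clm_apply hw
  have h2 : HasFDerivAt (fun y => J y (J y w)) (0 : V →L[ℝ] V) z :=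
    (hasFDerivAt_const (-w) z).congr_of_eventuallyEq (hJ2.mono fun y hy => hy w)
  have h3 := congrArg (fun L : V →L[ℝ] V => L v) (h1.unique h2)
  simp at h3
  exact eq_neg_of_add_eq_zero_right h3

theorem nijenhuisTensor_swap (J : V → V →L[ℝ] V) (z x y : V) :
    nijenhuisTensor J z x y = -nijenhuisTensor J z y x := by
  simp only [nijenhuisTensor]
  abel

theorem nijenhuisTensor_apply_left {J : V → V →L[ℝ] V} {z : V} (hJ : DifferentiableAt ℝ J z)
    (hJ2 : ∀ᶠ y in nhds z, ∀ w, J y (J y w) = -w) (x y : V) :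
    nijenhuisTensor J z (J z x) y = -J z (nijenhuisTensor J z x y) := by
  have h2 := hJ2.self_of_nhds
  simp only [nijenhuisTensor, fderiv_anticomm hJ hJ2, h2, map_sub, map_add, map_neg,
    neg_apply]
  abel

theorem nijenhuisTensor_add_left (J : V → V →L[ℝ] V) (z x₁ x₂ y : V) :
    nijenhuisTensor J z (x₁ + x₂) y = nijenhuisTensor J z x₁ y + nijenhuisTensor J z x₂ y := by
  simp only [nijenhuisTensor, map_add, add_apply]
  abel

theorem nijenhuisTensor_smul_left (J : V → V →L[ℝ] V) (z : V) (c : ℝ) (x y : V) :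
    nijenhuisTensor J z (c • x) y = c • nijenhuisTensor J z x y := by
  simp only [nijenhuisTensor, map_smul, smul_apply, smul_add, smul_sub]

/-- If the vectors `v i` and `J (v i)` span, then the Nijenhuis tensor is determined by its values
on the `v i`. -/
theorem nijenhuisTensor_eq_zero {J : V → V →L[ℝ] V} {z : V} (hJ : DifferentiableAt ℝ J z)
    (hJ2 : ∀ᶠ y in nhds z, ∀ w, J y (J y w) = -w) {ι : Type*} [Fintype ι] (v : ι → V)
    (hv : ∀ w, ∃ c d : ι → ℝ, w = ∑ i, c i • v i + J z (∑ i, d i • v i))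
    (h : ∀ i j, nijenhuisTensor J z (v i) (v j) = 0) (x y : V) : nijenhuisTensor J z x y = 0 := by
  have key : ∀ y, (∀ i, nijenhuisTensor J z (v i) y = 0) → ∀ x, nijenhuisTensor J z x y = 0 := by
    intro y hy x
    let T : V →ₗ[ℝ] V :=
      { toFun := fun x => nijenhuisTensor J z x y
        map_add' := fun a b => nijenhuisTensor_add_left J z a b y
        map_smul' := fun c a => nijenhuisTensor_smul_left J z c a y }
    have hT : ∀ c : ι → ℝ, nijenhuisTensor J z (∑ i, c i • v i) y = 0 := by
      intro c
      change T _ = 0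
      rw [map_sum]
      refine Finset.sum_eq_zero fun i _ => ?_
      rw [map_smul]
      change c i • nijenhuisTensor J z (v i) y = 0
      rw [hy i, smul_zero]
    obtain ⟨c, d, rfl⟩ := hv x
    rw [nijenhuisTensor_add_left, nijenhuisTensor_apply_left hJ hJ2, hT, hT]
    simp
  -- Antisymmetry reduces the second argument to the `v j` as well.
  refine key y (fun i => ?_) x
  rw [nijenhuisTensor_swap, key (v i) (fun j => h j i) y, neg_zero]

end Tensoriality

/-- The horizontal frame fields and their images under J all have constant base component, so the
scalar derivatives determine every Lie bracket in N. -/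
theorem HasDirDeriv.toLp {n : ℕ} {V : Type*} [NormedAddCommGroup V] [NormedSpace ℝ V]
    {F : Fin n → V → ℝ} {z w : V} {d : Fin n → ℝ} (h : ∀ i, HasDirDeriv (F i) z w (d i))
    (c : Coord n) :
    DifferentiableAt ℝ (fun y => (c, (WithLp.toLp 2 fun i => F i y : Coord n))) z ∧
      fderiv ℝ (fun y => (c, (WithLp.toLp 2 fun i => F i y : Coord n))) z w
        = (0, WithLp.toLp 2 d) := by
  have h1 : DifferentiableAt ℝ (fun y => (WithLp.toLp 2 fun i => F i y : Coord n)) z :=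
    differentiableAt_euclidean.2 fun i => (h i).1
  have h2 := (hasFDerivAt_const c z).prodMk h1.hasFDerivAt
  refine ⟨h2.differentiableAt, ?_⟩
  rw [h2.fderiv]
  refine Prod.ext (by simp) ?_
  ext i
  have h3 := ((EuclideanSpace.proj i : Coord n →L[ℝ] ℝ).hasFDerivAt.comp z h1.hasFDerivAt).fderiv
  have h4 := congrArg (fun L : V →L[ℝ] ℝ => L w) h3
  exact h4.symm.trans (h i).2

variable {n : ℕ} {M : Type*} [TopologicalSpace M] [ChartedSpace (Coord n) M]
  [IsManifold (𝓡 n) ∞ M]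

theorem sum_smul_verticalFrame (f : Fin n → ℝ) :
    ∑ j, f j • verticalFrame j = ((0, WithLp.toLp 2 f) : Coord n × Coord n) := by
  refine Prod.ext ?_ ?_
  · simp [verticalFrame, Prod.fst_sum]
  · ext k
    simp [verticalFrame, Prod.snd_sum, Pi.single_apply]

theorem horizontalFrame_eq (g : Metric n M) (e : OpenPartialHomeomorph M (Coord n))
    (z : Coord n × Coord n) (i : Fin n) :
    horizontalFrame g e z i
      = (EuclideanSpace.single i 1, WithLp.toLp 2 fun h => christoffelZero g e z i h) := by
  rw [horizontalFrame, sum_smul_verticalFrame]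
  simp

theorem contDiffOn_naturalJ (g : Metric n M) {e : OpenPartialHomeomorph M (Coord n)}
    (he : e ∈ IsManifold.maximalAtlas (𝓡 n) ∞ M) {a₁ a₂ b₁ b₂ : ℝ → ℝ}
    (ha₁ : ContDiffOn ℝ ∞ a₁ (Ici 0)) (ha₂ : ContDiffOn ℝ ∞ a₂ (Ici 0))
    (hb₁ : ContDiffOn ℝ ∞ b₁ (Ici 0)) (hb₂ : ContDiffOn ℝ ∞ b₂ (Ici 0)) :
    ContDiffOn ℝ ∞ (naturalJ g a₁ a₂ b₁ b₂ e) (inducedTarget e) := by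
  have hq : ∀ {f : Coord n → ℝ}, ContDiffOn ℝ ∞ f e.target →
      ContDiffOn ℝ ∞ (fun z : Coord n × Coord n => f z.1) (inducedTarget e) := fun hf =>
    hf.comp contDiffOn_fst fun z hz => hz.1
  have hp : ∀ i, ContDiffOn ℝ ∞ (fun z : Coord n × Coord n => z.2 i) (inducedTarget e) :=
    fun i => (dp i).contDiff.contDiffOn
  have hG : ∀ i j, ContDiffOn ℝ ∞ (fun z : Coord n × Coord n => metricMatrix g e z.1 i j)
    (inducedTarget e) := fun i j => hq (contDiffOn_metricMatrix g he i j)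
  have hI : ∀ i j, ContDiffOn ℝ ∞ (fun z : Coord n × Coord n => inverseMetric g e z.1 i j)
    (inducedTarget e) := fun i j => hq (contDiffOn_inverseMetric g he i j)
  have hE : ContDiffOn ℝ ∞ (energy g e) (inducedTarget e) :=
    contDiffOn_const.mul (ContDiffOn.sum fun i _ => ContDiffOn.sum fun k _ =>
      ((hI i k).mul (hp i)).mul (hp k))
  have hEa : ∀ {a : ℝ → ℝ}, ContDiffOn ℝ ∞ a (Ici 0) →
      ContDiffOn ℝ ∞ (fun z => a (energy g e z)) (inducedTarget e) := fun ha =>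
    ha.comp hE fun z hz => energy_nonneg g he hz
  have hR : ∀ i, ContDiffOn ℝ ∞ (fun z => raised g e z i) (inducedTarget e) := fun i =>
    ContDiffOn.sum fun h _ => (hp h).mul (hI h i)
  have hL : ∀ i j, ContDiffOn ℝ ∞ (fun z => lowerCoeff g a₁ b₁ e z i j) (inducedTarget e) :=
    fun i j => ((hEa ha₁).mul (hG i j)).add (((hEa hb₁).mul (hp i)).mul (hp j))
  have hU : ∀ i j, ContDiffOn ℝ ∞ (fun z => upperCoeff g a₂ b₂ e z i j) (inducedTarget e) :=
    fun i j => ((hEa ha₂).mul (hI i j)).add (((hEa hb₂).mul (hR i)).mul (hR j))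
  have hC : ∀ i j, ContDiffOn ℝ ∞ (fun z => christoffelZero g e z i j) (inducedTarget e) :=
    fun i j => ContDiffOn.sum fun k _ => (hp k).mul (hq (contDiffOn_christoffel g he k i j))
  have hX : ∀ j, ContDiffOn ℝ ∞ (fun z => horizontalFrame g e z j) (inducedTarget e) := fun j =>
    contDiffOn_const.add (ContDiffOn.sum fun h _ => (hC j h).smul contDiffOn_const)
  rw [contDiffOn_clm_apply]
  intro w
  have hD : ∀ i, ContDiffOn ℝ ∞ (fun z => covariantDp g e z i w) (inducedTarget e) := by
    intro i
    simp only [covariantDp, sum_apply, sub_apply, smul_apply]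
    exact contDiffOn_const.sub (ContDiffOn.sum fun j _ => (hC i j).smul contDiffOn_const)
  simp only [naturalJ, add_apply, sum_apply, ContinuousLinearMap.smulRight_apply]
  have hV : ∀ i, ContDiffOn ℝ ∞ (fun z => ∑ j, lowerCoeff g a₁ b₁ e z i j • verticalFrame j)
    (inducedTarget e) := fun i => ContDiffOn.sum fun j _ => (hL i j).smul contDiffOn_const
  exact ContDiffOn.add (ContDiffOn.sum fun i _ => (hV i).const_smul _) (ContDiffOn.sum fun i _ =>
    (hD i).smul (ContDiffOn.neg (ContDiffOn.sum fun j _ => (hU i j).smul (hX j))))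

/-- The function whose constancy is equivalent to the integrability of `J`. -/
def integrabilityFactor (a b : ℝ → ℝ) (t : ℝ) : ℝ :=
  (a t + 2 * t * b t) * derivWithin a (Ici 0) t - a t * b t

/-- Here g^{0j} g_{ij} = pᵢ and g^{0j} pⱼ = 2t. The factor a₁ + 2tb₁ enters `integrabilityFactor`,
and it governs invertibility of J in the direction of p. -/
theorem dotProduct_raised_lowerCoeff (g : Metric n M) {e : OpenPartialHomeomorph M (Coord n)}
    (he : e ∈ IsManifold.maximalAtlas (𝓡 n) ∞ M) (a b : ℝ → ℝ)
    {z : Coord n × Coord n} (hz : z ∈ inducedTarget e) (i : Fin n) :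
    dotProduct (raised g e z) (lowerCoeff g a b e z i)
      = (a (energy g e z) + 2 * energy g e z * b (energy g e z)) * z.2 i := by
  have h1 : dotProduct (raised g e z) z.2 = 2 * energy g e z := by
    simp only [dotProduct, raised, energy, Finset.sum_mul]
    rw [← mul_assoc, Finset.sum_comm]
    norm_num
    exact Finset.sum_congr rfl fun i _ => Finset.sum_congr rfl fun j _ => by ring
  have h2 : dotProduct (raised g e z) (metricMatrix g e z.1 i) = z.2 i := by
    have : dotProduct (raised g e z) (metricMatrix g e z.1 i)
        = Matrix.vecMul (raised g e z) (metricMatrix g e z.1) i := by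
      simp only [Matrix.vecMul, dotProduct]
      exact Finset.sum_congr rfl fun j _ => by rw [metricMatrix_symm]
    rw [this, raised_eq, Matrix.vecMul_vecMul, inverseMetric_mul_metricMatrix g he hz.1,
      Matrix.vecMul_one]
  have h3 : lowerCoeff g a b e z i = a (energy g e z) • metricMatrix g e z.1 i
      + (b (energy g e z) * z.2 i) • ⇑z.2 := by
    funext j
    simp [lowerCoeff]
  rw [h3, dotProduct_add, dotProduct_smul, dotProduct_smul, h1, h2, smul_eq_mul, smul_eq_mul]
  ring

theorem lowerCoeff_symm (g : Metric n M) (a b : ℝ → ℝ) (e : OpenPartialHomeomorph M (Coord n))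
    (z : Coord n × Coord n) (i j : Fin n) :
    lowerCoeff g a b e z i j = lowerCoeff g a b e z j i := by
  rw [lowerCoeff, lowerCoeff, metricMatrix_symm]
  ring

/-- The Nijenhuis tensor of `J` on the horizontal frame. -/
theorem nijenhuis_horizontalFrame (g : Metric n M) {e : OpenPartialHomeomorph M (Coord n)}
    (he : e ∈ IsManifold.maximalAtlas (𝓡 n) ∞ M) {a₁ b₁ : ℝ → ℝ} (a₂ b₂ : ℝ → ℝ)
    (ha₁ : DifferentiableOn ℝ a₁ (Ici 0)) (hb₁ : DifferentiableOn ℝ b₁ (Ici 0))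
    {z : Coord n × Coord n} (hz : z ∈ inducedTarget e) (i j : Fin n) :
    nijenhuis (naturalJ g a₁ a₂ b₁ b₂ e) (fun y => horizontalFrame g e y i)
        (fun y => horizontalFrame g e y j) z
      = (0, WithLp.toLp 2 fun h => integrabilityFactor a₁ b₁ (energy g e z)
          * (z.2 i * metricMatrix g e z.1 j h - z.2 j * metricMatrix g e z.1 i h)
          - ∑ k, z.2 k * curvature g e k h i j z.1) := by
  set L := lowerCoeff g a₁ b₁ e z with hL
  have hX : ∀ i, (fun y => horizontalFrame g e y i) = fun y =>
      (EuclideanSpace.single i 1, WithLp.toLp 2 fun h => christoffelZero g e y i h) :=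
    fun i => funext fun y => horizontalFrame_eq g e y i
  have hJX : ∀ i, (fun y => naturalJ g a₁ a₂ b₁ b₂ e y (horizontalFrame g e y i)) = fun y =>
      (0, WithLp.toLp 2 fun h => lowerCoeff g a₁ b₁ e y i h) := fun i => funext fun y => by
    rw [naturalJ_horizontalFrame, sum_smul_verticalFrame]
  have hXX := fun i j => (HasDirDeriv.toLp (fun h => hasDirDeriv_christoffelZero_horizontal g he
    (w := (EuclideanSpace.single i 1, WithLp.toLp 2 fun h => christoffelZero g e z i h)) hz
    (k := i) rfl j h) (EuclideanSpace.single j 1)).2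
  have hXJ := fun i j => (HasDirDeriv.toLp (fun h => hasDirDeriv_christoffelZero_vertical g he
    (w := (0, WithLp.toLp 2 fun h => L i h)) hz rfl j h) (EuclideanSpace.single j 1)).2
  have hJXX := fun i j => (HasDirDeriv.toLp (fun h => hasDirDeriv_lowerCoeff_horizontal g he ha₁ hb₁
    (w := (EuclideanSpace.single i 1, WithLp.toLp 2 fun h => christoffelZero g e z i h)) hz
    (k := i) rfl rfl j h) 0).2
  have hJXJ := fun i j => (HasDirDeriv.toLp (fun h => hasDirDeriv_lowerCoeff_vertical g he ha₁ hb₁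
    (w := (0, WithLp.toLp 2 fun h => L i h)) hz rfl j h) 0).2
  -- As J⁽¹⁾ is parallel, each mixed bracket reduces to a single term Γ^l_{ij} J⁽¹⁾_{lh}, up to
  -- sign; symmetry of Γ makes the two cancel.
  have b1 : VectorField.lieBracket ℝ
      (fun y => naturalJ g a₁ a₂ b₁ b₂ e y (horizontalFrame g e y i))
      (fun y => horizontalFrame g e y j) z
      + VectorField.lieBracket ℝ (fun y => horizontalFrame g e y i)
      (fun y => naturalJ g a₁ a₂ b₁ b₂ e y (horizontalFrame g e y j)) z = 0 := by
    rw [hJX i, hJX j, hX i, hX j]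
    simp only [VectorField.lieBracket, ← hL]
    rw [hXJ i j, hJXX j i, hJXX i j, hXJ j i]
    refine Prod.ext (by simp) ?_
    ext h
    have : ∀ l, christoffel g e l i j z.1 = christoffel g e l j i z.1 := fun l => by
      rw [christoffel_symm]
    simp [← hL, this]
  have b2 : VectorField.lieBracket ℝ
      (fun y => naturalJ g a₁ a₂ b₁ b₂ e y (horizontalFrame g e y i))
      (fun y => naturalJ g a₁ a₂ b₁ b₂ e y (horizontalFrame g e y j)) z
      = (0, WithLp.toLp 2 fun h => integrabilityFactor a₁ b₁ (energy g e z)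
          * (z.2 i * metricMatrix g e z.1 j h - z.2 j * metricMatrix g e z.1 i h)) := by
    rw [hJX i, hJX j]
    simp only [VectorField.lieBracket, ← hL]
    rw [hJXJ i j, hJXJ j i]
    refine Prod.ext (by simp) ?_
    ext h
    have hr : ∀ k, dotProduct (raised g e z) (fun h => L k h)
      = (a₁ (energy g e z) + 2 * energy g e z * b₁ (energy g e z)) * z.2 k := fun k =>
        dotProduct_raised_lowerCoeff g he a₁ b₁ hz k
    simp only [hr, Prod.snd_sub, PiLp.sub_apply]
    -- The terms in b₁', in b₁² and with J⁽¹⁾_{ij} are symmetric in i and j, so they drop out of the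
    -- bracket.
    rw [hL, lowerCoeff_symm g a₁ b₁ e z j i]
    simp only [lowerCoeff, integrabilityFactor]
    ring
  -- Curvature measures the failure of the horizontal distribution to be involutive.
  have b3 : VectorField.lieBracket ℝ (fun y => horizontalFrame g e y i)
      (fun y => horizontalFrame g e y j) z
      = (0, WithLp.toLp 2 fun h => ∑ k, z.2 k * curvature g e k h i j z.1) := by
    rw [hX i, hX j]
    simp only [VectorField.lieBracket]
    rw [hXX i j, hXX j i]
    refine Prod.ext (by simp) ?_
    ext h
    have hs : ∀ i j, ∑ l, christoffelZero g e z i l * christoffel g e l j h z.1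
        = ∑ k, z.2 k * ∑ l, christoffel g e k i l z.1 * christoffel g e l j h z.1 := by
      intro i j
      simp only [christoffelZero, Finset.sum_mul, Finset.mul_sum]
      rw [Finset.sum_comm]
      exact Finset.sum_congr rfl fun k _ => Finset.sum_congr rfl fun l _ => by ring
    simp only [Prod.snd_sub, PiLp.sub_apply, Finset.sum_add_distrib, hs, curvature,
      Finset.sum_sub_distrib, mul_add, mul_sub]
    ring
  have b4 : nijenhuis (naturalJ g a₁ a₂ b₁ b₂ e) (fun y => horizontalFrame g e y i)
        (fun y => horizontalFrame g e y j) z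
      = VectorField.lieBracket ℝ
      (fun y => naturalJ g a₁ a₂ b₁ b₂ e y (horizontalFrame g e y i))
      (fun y => naturalJ g a₁ a₂ b₁ b₂ e y (horizontalFrame g e y j)) z
      - naturalJ g a₁ a₂ b₁ b₂ e z (VectorField.lieBracket ℝ
      (fun y => naturalJ g a₁ a₂ b₁ b₂ e y (horizontalFrame g e y i))
      (fun y => horizontalFrame g e y j) z
      + VectorField.lieBracket ℝ (fun y => horizontalFrame g e y i)
      (fun y => naturalJ g a₁ a₂ b₁ b₂ e y (horizontalFrame g e y j)) z)
      - VectorField.lieBracket ℝ (fun y => horizontalFrame g e y i)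
      (fun y => horizontalFrame g e y j) z := by
    rw [map_add, ← sub_sub]
    rfl
  rw [b4, b1, b2, b3, map_zero, sub_zero]
  refine Prod.ext (by simp) ?_
  ext h
  simp

theorem differentiableAt_horizontalFrame (g : Metric n M)
    {e : OpenPartialHomeomorph M (Coord n)} (he : e ∈ IsManifold.maximalAtlas (𝓡 n) ∞ M)
    {z : Coord n × Coord n} (hz : z ∈ inducedTarget e) (i : Fin n) :
    DifferentiableAt ℝ (fun y => horizontalFrame g e y i) z := by
  have hX : (fun y => horizontalFrame g e y i) = fun y =>
      (EuclideanSpace.single i 1, WithLp.toLp 2 fun h => christoffelZero g e y i h) :=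
    funext fun y => horizontalFrame_eq g e y i
  rw [hX]
  exact (HasDirDeriv.toLp (fun h => hasDirDeriv_christoffelZero_vertical g he
    (w := 0) hz rfl i h) (EuclideanSpace.single i 1)).1

/-- J maps vertical vectors to horizontal ones; a second application and J² = -I exhibit each
vertical vector as J of a horizontal one. -/
theorem exists_eq_sum_horizontalFrame (g : Metric n M) {e : OpenPartialHomeomorph M (Coord n)}
    {a₁ a₂ b₁ b₂ : ℝ → ℝ} {z : Coord n × Coord n}
    (hJ2 : ∀ w, naturalJ g a₁ a₂ b₁ b₂ e z (naturalJ g a₁ a₂ b₁ b₂ e z w) = -w)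
    (w : Coord n × Coord n) :
    ∃ c d : Fin n → ℝ, w = ∑ i, c i • horizontalFrame g e z i
      + naturalJ g a₁ a₂ b₁ b₂ e z (∑ i, d i • horizontalFrame g e z i) := by
  set v : Coord n := w.2 - ∑ i, w.1 i • (horizontalFrame g e z i).2 with hv
  have h1 : w = ∑ i, w.1 i • horizontalFrame g e z i + ∑ j, v j • verticalFrame j := by
    rw [sum_smul_verticalFrame]
    refine Prod.ext ?_ ?_
    · ext k
      simp [horizontalFrame_eq, Prod.fst_sum, Pi.single_apply]
    · simp [hv, Prod.snd_sum]
  refine ⟨fun i => w.1 i, fun j => ∑ i, v i * upperCoeff g a₂ b₂ e z i j, ?_⟩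
  have h2 : naturalJ g a₁ a₂ b₁ b₂ e z (∑ j, v j • verticalFrame j)
      = -∑ j, (∑ i, v i * upperCoeff g a₂ b₂ e z i j) • horizontalFrame g e z j := by
    simp only [map_sum, map_smul, naturalJ_verticalFrame, Finset.sum_smul, smul_neg,
      Finset.smul_sum, smul_smul, Finset.sum_neg_distrib]
    rw [Finset.sum_comm]
  have h3 := hJ2 (∑ j, v j • verticalFrame j)
  rw [h2, map_neg] at h3
  rw [neg_injective h3]
  exact h1

/-- `J` is integrable if and only if its Nijenhuis tensor vanishes on the horizontal frames. -/
theorem isIntegrable_iff (g : Metric n M) {a₁ a₂ b₁ b₂ : ℝ → ℝ}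
    (ha₁ : ContDiffOn ℝ ∞ a₁ (Ici 0)) (ha₂ : ContDiffOn ℝ ∞ a₂ (Ici 0))
    (hb₁ : ContDiffOn ℝ ∞ b₁ (Ici 0)) (hb₂ : ContDiffOn ℝ ∞ b₂ (Ici 0))
    (hJ : IsAlmostComplex g a₁ a₂ b₁ b₂) :
    IsIntegrable g a₁ a₂ b₁ b₂ ↔ ∀ e ∈ IsManifold.maximalAtlas (𝓡 n) ∞ M,
      ∀ z ∈ inducedTarget e, ∀ i j h : Fin n,
        ∑ k, z.2 k * curvature g e k h i j z.1 = integrabilityFactor a₁ b₁ (energy g e z)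
          * (z.2 i * metricMatrix g e z.1 j h - z.2 j * metricMatrix g e z.1 i h) := by
  have hd : ∀ e ∈ IsManifold.maximalAtlas (𝓡 n) ∞ M, ∀ z ∈ inducedTarget e,
      DifferentiableAt ℝ (naturalJ g a₁ a₂ b₁ b₂ e) z := fun e he z hz =>
    ((contDiffOn_naturalJ g he ha₁ ha₂ hb₁ hb₂).contDiffAt
      ((isOpen_inducedTarget e).mem_nhds hz)).differentiableAt (by simp)
  have hframe : ∀ e ∈ IsManifold.maximalAtlas (𝓡 n) ∞ M, ∀ z ∈ inducedTarget e, ∀ i j,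
      nijenhuisTensor (naturalJ g a₁ a₂ b₁ b₂ e) z (horizontalFrame g e z i)
        (horizontalFrame g e z j)
      = (0, WithLp.toLp 2 fun h => integrabilityFactor a₁ b₁ (energy g e z)
          * (z.2 i * metricMatrix g e z.1 j h - z.2 j * metricMatrix g e z.1 i h)
          - ∑ k, z.2 k * curvature g e k h i j z.1) := by
    intro e he z hz i j
    rw [← nijenhuis_horizontalFrame g he a₂ b₂ (ha₁.differentiableOn (by simp))
        (hb₁.differentiableOn (by simp)) hz i j]
    exact (nijenhuis_eq_nijenhuisTensor (hd e he z hz) (hJ e he z hz)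
      (differentiableAt_horizontalFrame g he hz i)
      (differentiableAt_horizontalFrame g he hz j)).symm
  constructor
  · intro hI e he z hz i j h
    -- Freezing the frame at `z` gives constant fields, which are smooth; by tensoriality N takes
    -- the same value on them.
    have h1 := hI e he (fun _ => horizontalFrame g e z i) (fun _ => horizontalFrame g e z j)
      contDiffOn_const contDiffOn_const z hz
    rw [nijenhuis_eq_nijenhuisTensor (hd e he z hz) (hJ e he z hz)
      (differentiableAt_const _) (differentiableAt_const _), hframe e he z hz] at h1
    have h2 := congrArg (fun w : Coord n × Coord n => w.2 h) h1
    simp at h2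
    linarith
  · intro H e he X Y hX hY z hz
    have hopen := (isOpen_inducedTarget e).mem_nhds hz
    rw [nijenhuis_eq_nijenhuisTensor (hd e he z hz) (hJ e he z hz)
      ((hX.contDiffAt hopen).differentiableAt (by simp))
      ((hY.contDiffAt hopen).differentiableAt (by simp))]
    refine nijenhuisTensor_eq_zero (hd e he z hz)
      (Filter.mem_of_superset hopen fun y hy => hJ e he y hy) (horizontalFrame g e z)
      (exists_eq_sum_horizontalFrame g (hJ e he z hz)) (fun i j => ?_) _ _
    rw [hframe e he z hz]
    simp only [H e he z hz, sub_self]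
    rfl

end

/-! ### Constant sectional curvature as an identity for the curvature tensor -/

section

/-- A curvature-like form with vanishing sectional curvatures is zero. -/
theorem curvatureLike_eq_zero {V : Type*} [AddCommGroup V] {D : V → V → V → V → ℝ}
    (hadd : ∀ u u' v w y, D (u + u') v w y = D u v w y + D u' v w y)
    (hswap : ∀ u v w y, D u v w y = -D v u w y)
    (hskew : ∀ u v w y, D u v w y = -D u v y w)
    (hbianchi : ∀ u v w y, D u v w y + D v w u y + D w u v y = 0)
    (hsec : ∀ u v, D u v v u = 0) (u v w y : V) : D u v w y = 0 := by
  -- Pair symmetry follows from the four Bianchi identities on the arguments together with both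
  -- antisymmetries.
  have hpair : ∀ u v w y, D u v w y = D w y u v := by
    intro u v w y
    linarith [hbianchi u v w y, hbianchi v w y u, hbianchi w y u v, hbianchi y u v w,
      hswap u v w y, hswap v w u y, hswap w u v y, hskew u v w y, hskew v w u y, hskew w u v y,
      hskew v w y u, hskew w y v u, hskew y v w u, hswap w y v u, hswap y v w u,
      hskew w y u v, hskew y u w v, hskew u w y v, hswap y u w v, hswap u w y v,
      hskew y u v w, hskew u v y w, hskew v y u w, hswap u v y w, hswap v y u w,
      hswap v y w u, hswap u y v w, hswap u y w v, hswap w u y v, hskew w u y v, hskew u y v w,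
      hskew v y w u]
  have hadd4 : ∀ u v w y y', D u v w (y + y') = D u v w y + D u v w y' := by
    intro u v w y y'
    rw [hpair, hswap, hadd, hpair u v w y, hpair u v w y', hswap w y, hswap w y']
    ring
  have hadd2 : ∀ u v v' w y, D u (v + v') w y = D u v w y + D u v' w y := by
    intro u v v' w y
    rw [hswap, hadd, hswap u v, hswap u v']
    ring
  have hadd3 : ∀ u v w w' y, D u v (w + w') y = D u v w y + D u v w' y := by
    intro u v w w' y
    rw [hpair, hadd, hpair u v w y, hpair u v w' y]
  -- Polarisation in the outer arguments; polarising next in the middle ones makes `D` alternating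
  -- in its first three arguments, so Bianchi reads 3D = 0.
  have h1 : ∀ u v y, D u v v y = 0 := by
    intro u v y
    have h := hsec (u + y) v
    rw [hadd, hadd4, hadd4, hsec, hsec] at h
    have h' : D y v v u = D u v v y := by
      rw [hpair y v v u, hswap, hskew, neg_neg]
    linarith
  have h2 : ∀ u v w y, D u v w y = -D u w v y := by
    intro u v w y
    have h := h1 u (v + w) y
    rw [hadd2, hadd3, hadd3, h1, h1] at h
    linarith
  linarith [hbianchi u v w y, h2 u v w y, h2 v w u y, hswap v u w y, hswap w u v y]

variable {n : ℕ} {M : Type*} [TopologicalSpace M] [ChartedSpace (Coord n) M]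
  [IsManifold (𝓡 n) ∞ M]

theorem metricForm_symm (g : Metric n M) (e : OpenPartialHomeomorph M (Coord n))
    (x u v : Coord n) : metricForm g e x u v = metricForm g e x v u := by
  simp only [metricForm]
  rw [Finset.sum_comm]
  exact Finset.sum_congr rfl fun i _ => Finset.sum_congr rfl fun j _ => by
    rw [metricMatrix_symm]; ring

theorem metricForm_add_left (g : Metric n M) (e : OpenPartialHomeomorph M (Coord n))
    (x u u' v : Coord n) :
    metricForm g e x (u + u') v = metricForm g e x u v + metricForm g e x u' v := by
  simp [metricForm_eq_dotProduct]

theorem metricForm_smul_left (g : Metric n M) (e : OpenPartialHomeomorph M (Coord n))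
    (x u v : Coord n) (c : ℝ) :
    metricForm g e x (c • u) v = c * metricForm g e x u v := by
  simp [metricForm_eq_dotProduct]

theorem metricForm_sub_left (g : Metric n M) (e : OpenPartialHomeomorph M (Coord n))
    (x u u' v : Coord n) :
    metricForm g e x (u - u') v = metricForm g e x u v - metricForm g e x u' v := by
  simp [metricForm_eq_dotProduct]

/-- The strict Cauchy-Schwarz inequality. -/
theorem metricForm_gram_pos (g : Metric n M) {e : OpenPartialHomeomorph M (Coord n)}
    (he : e ∈ IsManifold.maximalAtlas (𝓡 n) ∞ M) {x : Coord n} (hx : x ∈ e.target)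
    {u v : Coord n} (huv : LinearIndependent ℝ ![u, v]) :
    0 < metricForm g e x u u * metricForm g e x v v - metricForm g e x u v ^ 2 := by
  have hv : v ≠ 0 := huv.ne_zero 1
  have hvv := metricForm_pos g he hx hv
  set w := metricForm g e x v v • u - metricForm g e x u v • v with hw
  have hw0 : w ≠ 0 := by
    intro h0
    have := LinearIndependent.pair_iff.1 huv (metricForm g e x v v) (-metricForm g e x u v)
      (by rw [← h0, hw]; module)
    exact hvv.ne' this.1
  have h1 := metricForm_pos g he hx hw0
  have h2 : metricForm g e x w w = metricForm g e x v v *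
      (metricForm g e x u u * metricForm g e x v v - metricForm g e x u v ^ 2) := by
    rw [hw, metricForm_sub_left, metricForm_smul_left, metricForm_smul_left,
      metricForm_symm g e x u (_ - _), metricForm_symm g e x v (_ - _), metricForm_sub_left,
      metricForm_smul_left, metricForm_smul_left, metricForm_sub_left,
      metricForm_smul_left, metricForm_smul_left, metricForm_symm g e x v u]
    ring
  rw [h2] at h1
  exact pos_of_mul_pos_right h1 hvv.le

theorem metricForm_curvatureVector (g : Metric n M) (e : OpenPartialHomeomorph M (Coord n))
    (x u v w y : Coord n) :
    metricForm g e x (curvatureVector g e x u v w) y = ∑ i, ∑ j, u i * v j *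
      dotProduct y (Matrix.mulVec (metricMatrix g e x * curvatureMatrix g e x i j) w) := by
  have h1 : curvatureVector g e x u v w = WithLp.toLp 2 (∑ i, ∑ j, (u i * v j) •
      Matrix.mulVec (curvatureMatrix g e x i j) w) := by
    ext h
    simp only [curvatureVector, Finset.sum_apply, Pi.smul_apply, Matrix.mulVec, dotProduct,
      curvatureMatrix, Matrix.of_apply, smul_eq_mul, Finset.mul_sum]
    rw [Finset.sum_comm]
    refine Finset.sum_congr rfl fun i _ => ?_
    rw [Finset.sum_comm]
    exact Finset.sum_congr rfl fun i _ => Finset.sum_congr rfl fun j _ => by ring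
  rw [metricForm_symm, metricForm_eq_dotProduct, h1]
  simp only [Matrix.mulVec_sum, Matrix.mulVec_smul, dotProduct_sum, dotProduct_smul,
    Matrix.mulVec_mulVec, smul_eq_mul]

/-- The lowered vector `y` takes the place of the covector p, matching the contraction that appears
in the Nijenhuis tensor. -/
theorem metricForm_curvatureVector_eq_sum (g : Metric n M)
    (e : OpenPartialHomeomorph M (Coord n)) (x u v w y : Coord n) :
    metricForm g e x (curvatureVector g e x u v w) y = ∑ i, ∑ j, ∑ h, u i * v j * w h *
      ∑ k, Matrix.mulVec (metricMatrix g e x) y k * curvature g e k h i j x := by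
  rw [metricForm_curvatureVector]
  refine Finset.sum_congr rfl fun i _ => Finset.sum_congr rfl fun j _ => ?_
  rw [← Matrix.mulVec_mulVec, Matrix.dotProduct_mulVec, ← Matrix.mulVec_transpose,
    transpose_metricMatrix]
  simp only [dotProduct, Matrix.mulVec, curvatureMatrix, Matrix.of_apply]
  simp only [Finset.mul_sum _ _ (u.ofLp i * v.ofLp j)]
  simp only [Finset.mul_sum]
  rw [Finset.sum_comm]
  exact Finset.sum_congr rfl fun i _ => Finset.sum_congr rfl fun j _ => by ring

/-- The condition `R^k_{hij} = c (δ^k_i g_{jh} - δ^k_j g_{ih})` at the point `x`, contracted with an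
arbitrary covector. -/
def HasSpaceFormCurvature (g : Metric n M) (e : OpenPartialHomeomorph M (Coord n)) (x : Coord n)
    (c : ℝ) : Prop :=
  ∀ (p : Coord n) (i j h : Fin n), ∑ k, p k * curvature g e k h i j x
    = c * (p i * metricMatrix g e x j h - p j * metricMatrix g e x i h)

theorem HasSpaceFormCurvature.metricForm_curvatureVector {g : Metric n M}
    {e : OpenPartialHomeomorph M (Coord n)} {x : Coord n} {c : ℝ}
    (H : HasSpaceFormCurvature g e x c) (u v w y : Coord n) :
    metricForm g e x (curvatureVector g e x u v w) y = c * (metricForm g e x u y *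
      metricForm g e x v w - metricForm g e x v y * metricForm g e x u w) := by
  rw [metricForm_curvatureVector_eq_sum]
  have H' := H (WithLp.toLp 2 (Matrix.mulVec (metricMatrix g e x) y))
  simp only at H'
  simp only [H', metricForm_eq_dotProduct]
  set q := Matrix.mulVec (metricMatrix g e x) y with hq
  simp only [dotProduct, Matrix.mulVec]
  have e1 : ∀ a b : Coord n, (∑ i, a i * q i) * (∑ j, b j * ∑ h, metricMatrix g e x j h * w h)
      = ∑ i, ∑ j, ∑ h, a i * q i * (b j * (metricMatrix g e x j h * w h)) := by
    intro a b
    rw [Finset.sum_mul_sum]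
    simp only [Finset.mul_sum]
  rw [e1 u v, e1 v u, Finset.sum_comm (f := fun i j => ∑ h, v i * q i * (u j * _)),
    ← Finset.sum_sub_distrib, Finset.mul_sum]
  refine Finset.sum_congr rfl fun i _ => ?_
  rw [← Finset.sum_sub_distrib, Finset.mul_sum]
  refine Finset.sum_congr rfl fun j _ => ?_
  rw [← Finset.sum_sub_distrib, Finset.mul_sum]
  exact Finset.sum_congr rfl fun h _ => by ring

theorem HasSpaceFormCurvature.sectionalCurvature_eq {g : Metric n M}
    {e : OpenPartialHomeomorph M (Coord n)} (he : e ∈ IsManifold.maximalAtlas (𝓡 n) ∞ M)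
    {x : Coord n} (hx : x ∈ e.target) {c : ℝ} (H : HasSpaceFormCurvature g e x c)
    {u v : Coord n} (huv : LinearIndependent ℝ ![u, v]) : sectionalCurvature g e x u v = c := by
  have h := metricForm_gram_pos g he hx huv
  rw [sectionalCurvature, div_eq_iff h.ne', H.metricForm_curvatureVector,
    metricForm_symm g e x v u]
  ring

/-- The difference of the two sides is curvature-like in (u, v, w, y) and has vanishing sectional
curvatures. -/
theorem metricForm_curvatureVector_eq_of_sectionalCurvature_eq {g : Metric n M}
    {e : OpenPartialHomeomorph M (Coord n)} (he : e ∈ IsManifold.maximalAtlas (𝓡 n) ∞ M)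
    {x : Coord n} (hx : x ∈ e.target) {c : ℝ}
    (H : ∀ u v, LinearIndependent ℝ ![u, v] → sectionalCurvature g e x u v = c)
    (u v w y : Coord n) :
    metricForm g e x (curvatureVector g e x u v w) y = c * (metricForm g e x u y *
      metricForm g e x v w - metricForm g e x v y * metricForm g e x u w) := by
  rw [← sub_eq_zero]
  have hswapR : ∀ u v w y, metricForm g e x (curvatureVector g e x u v w) y
      = -metricForm g e x (curvatureVector g e x v u w) y := by
    intro u v w y
    rw [metricForm_curvatureVector, metricForm_curvatureVector, Finset.sum_comm,
      ← Finset.sum_neg_distrib]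
    refine Finset.sum_congr rfl fun i _ => ?_
    rw [← Finset.sum_neg_distrib]
    refine Finset.sum_congr rfl fun j _ => ?_
    have : curvatureMatrix g e x j i = -curvatureMatrix g e x i j := by
      ext h k
      exact curvature_swap g e h k j i x
    rw [this, mul_neg, Matrix.neg_mulVec, dotProduct_neg]
    ring
  have hskewR : ∀ u v w y, metricForm g e x (curvatureVector g e x u v w) y
      = -metricForm g e x (curvatureVector g e x u v y) w := by
    intro u v w y
    rw [metricForm_curvatureVector, metricForm_curvatureVector, ← Finset.sum_neg_distrib]
    refine Finset.sum_congr rfl fun i _ => ?_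
    rw [← Finset.sum_neg_distrib]
    refine Finset.sum_congr rfl fun j _ => ?_
    have h1 : (metricMatrix g e x * curvatureMatrix g e x i j).transpose
        = -(metricMatrix g e x * curvatureMatrix g e x i j) := by
      rw [Matrix.transpose_mul, transpose_metricMatrix]
      exact eq_neg_of_add_eq_zero_left (curvatureMatrix_skew g he hx i j)
    rw [Matrix.dotProduct_mulVec, ← Matrix.mulVec_transpose, h1, Matrix.neg_mulVec, neg_dotProduct,
      dotProduct_comm]
    ring
  have haddR : ∀ u u' v w y, metricForm g e x (curvatureVector g e x (u + u') v w) y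
      = metricForm g e x (curvatureVector g e x u v w) y
        + metricForm g e x (curvatureVector g e x u' v w) y := by
    intro u u' v w y
    simp only [metricForm_curvatureVector, PiLp.add_apply, add_mul, Finset.sum_add_distrib]
  have hbianchiR : ∀ u v w y, metricForm g e x (curvatureVector g e x u v w) y
      + metricForm g e x (curvatureVector g e x v w u) y
      + metricForm g e x (curvatureVector g e x w u v) y = 0 := by
    intro u v w y
    simp only [metricForm_curvatureVector_eq_sum]
    set q := Matrix.mulVec (metricMatrix g e x) y
    -- Cyclic relabelling of the summation indices brings the three sums to a common index triple.
    have e2 : ∀ F : Fin n → Fin n → Fin n → ℝ, ∑ a, ∑ b, ∑ c, F a b c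
        = ∑ i, ∑ j, ∑ k, F j k i := fun F => by
      rw [Finset.sum_comm]
      conv_rhs => rw [Finset.sum_comm' (t' := Finset.univ) (s' := fun _ => Finset.univ) (by simp)]
      rw [Finset.sum_comm]
      exact Finset.sum_congr rfl fun a _ => by rw [Finset.sum_comm]
    have e3 : ∀ F : Fin n → Fin n → Fin n → ℝ, ∑ a, ∑ b, ∑ c, F a b c
        = ∑ i, ∑ j, ∑ k, F k i j := fun F => by rw [e2, e2]
    rw [e2 fun a b c => v a * w b * u c * _, e3 fun a b c => w a * u b * v c * _]
    simp only [← Finset.sum_add_distrib]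
    refine Finset.sum_eq_zero fun i _ => Finset.sum_eq_zero fun j _ =>
      Finset.sum_eq_zero fun k _ => ?_
    have h1 : ∑ l, q l * curvature g e l k i j x + ∑ l, q l * curvature g e l i j k x
        + ∑ l, q l * curvature g e l j k i x = 0 := by
      rw [← Finset.sum_add_distrib, ← Finset.sum_add_distrib]
      refine Finset.sum_eq_zero fun l _ => ?_
      rw [← mul_add, ← mul_add, curvature_bianchi, mul_zero]
    linear_combination (u i * v j * w k) * h1
  refine curvatureLike_eq_zero (D := fun u v w y =>
    metricForm g e x (curvatureVector g e x u v w) y - c * (metricForm g e x u y *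
      metricForm g e x v w - metricForm g e x v y * metricForm g e x u w)) ?_ ?_ ?_ ?_ ?_ u v w y
  · intro u u' v w y
    simp only [haddR, metricForm_add_left]
    ring
  · intro u v w y
    simp only [hswapR u v w y]
    ring
  · intro u v w y
    simp only [hskewR u v w y]
    ring
  · intro u v w y
    have := hbianchiR u v w y
    simp only [metricForm_symm g e x w u, metricForm_symm g e x w v, metricForm_symm g e x v u]
    linarith
  · intro u v
    by_cases huv : LinearIndependent ℝ ![u, v]
    · have h1 := metricForm_gram_pos g he hx huv
      have h2 := H u v huv
      rw [sectionalCurvature, div_eq_iff h1.ne'] at h2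
      rw [h2, metricForm_symm g e x v u]
      ring
    -- For a dependent pair the hypothesis says nothing, but both sides vanish by antisymmetry in u
    -- and v.
    · have h0 : ∀ v w y, metricForm g e x (curvatureVector g e x v v w) y = 0 := fun v w y => by
        linarith [hswapR v v w y]
      have hsm : ∀ a u v w y, metricForm g e x (curvatureVector g e x (a • u) v w) y
          = a * metricForm g e x (curvatureVector g e x u v w) y := by
        intro a u v w y
        simp only [metricForm_curvatureVector, PiLp.smul_apply, smul_eq_mul, Finset.mul_sum]
        exact Finset.sum_congr rfl fun i _ => Finset.sum_congr rfl fun j _ => by ring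
      have hz : ∀ v w y, metricForm g e x (curvatureVector g e x 0 v w) y = 0 := by
        intro v w y
        have := hsm 0 0 v w y
        rwa [zero_smul, zero_mul] at this
      have hm0 : ∀ v, metricForm g e x 0 v = 0 := by
        intro v
        have := metricForm_smul_left g e x 0 v 0
        rwa [zero_smul, zero_mul] at this
      by_cases hv : v = 0
      · subst hv
        rw [hswapR, hz, metricForm_symm g e x u 0, hm0]
        simp [hm0]
      · obtain ⟨a, ha⟩ : ∃ a : ℝ, a • v = u := by
          by_contra! hcon
          exact huv ((LinearIndependent.pair_symm_iff).1
            ((LinearIndependent.pair_iff' hv).2 hcon))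
        rw [← ha, hsm, h0, metricForm_smul_left, metricForm_symm g e x v (a • v),
          metricForm_smul_left]
        ring

theorem hasSpaceFormCurvature_of_sectionalCurvature_eq {g : Metric n M}
    {e : OpenPartialHomeomorph M (Coord n)} (he : e ∈ IsManifold.maximalAtlas (𝓡 n) ∞ M)
    {x : Coord n} (hx : x ∈ e.target) {c : ℝ}
    (H : ∀ u v, LinearIndependent ℝ ![u, v] → sectionalCurvature g e x u v = c) :
    HasSpaceFormCurvature g e x c := by
  intro p i j h
  -- The last argument is p with its index raised, so that lowering it returns p.
  have h1 := metricForm_curvatureVector_eq_of_sectionalCurvature_eq he hx H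
    (EuclideanSpace.single i 1) (EuclideanSpace.single j 1) (EuclideanSpace.single h 1)
    (WithLp.toLp 2 (Matrix.mulVec (inverseMetric g e x) p))
  rw [metricForm_curvatureVector_eq_sum] at h1
  have h2 : Matrix.mulVec (metricMatrix g e x) (Matrix.mulVec (inverseMetric g e x) p) = p := by
    rw [Matrix.mulVec_mulVec, metricMatrix_mul_inverseMetric g he hx, Matrix.one_mulVec]
  simp only [metricForm_eq_dotProduct, h2] at h1
  simpa [Pi.single_apply, ite_mul, mul_ite, Matrix.mulVec, dotProduct] using h1

end

/-! ### The scalar equation on [0, ∞) -/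

section

theorem pos_of_continuousOn_of_ne_zero {f : ℝ → ℝ} (hf : ContinuousOn f (Ici 0)) (h0 : 0 < f 0)
    (hne : ∀ t, 0 ≤ t → f t ≠ 0) {t : ℝ} (ht : 0 ≤ t) : 0 < f t := by
  by_contra hcon
  obtain ⟨s, hs, hs0⟩ := isPreconnected_Ici.intermediate_value (mem_Ici.2 ht) (mem_Ici.2 le_rfl) hf
    ⟨not_lt.1 hcon, h0.le⟩
  exact hne s hs hs0

/-- A solution on `[0, ∞)` of a homogeneous linear ODE which is positive at `0` is positive. -/
theorem pos_of_linear_ode {u k : ℝ → ℝ} (hk : ContinuousOn k (Ici 0))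
    (hu : ∀ t, 0 ≤ t → HasDerivWithinAt u (k t * u t) (Ici 0) t) (h0 : 0 < u 0) {t : ℝ}
    (ht : 0 ≤ t) : 0 < u t := by
  have hc : ContinuousOn u (Ici 0) := fun s hs => (hu s hs).continuousWithinAt
  -- A zero at `s` would force u = 0 on [0, s] by uniqueness backwards from `s`. The bound `K` of k
  -- on [0, s] is the Lipschitz constant, and at 0 only continuity is needed.
  refine pos_of_continuousOn_of_ne_zero hc h0 (fun s hs hs0 => ?_) ht
  obtain ⟨K, hK⟩ := (isCompact_Icc (a := (0 : ℝ)) (b := s)).exists_bound_of_continuousOn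
    (hk.mono Icc_subset_Ici_self)
  have hv : ∀ r ∈ Ioc 0 s, LipschitzOnWith K.toNNReal (fun x => k r * x) univ := by
    intro r hr
    refine LipschitzOnWith.of_dist_le_mul fun x _ y _ => ?_
    rw [Real.dist_eq, Real.dist_eq, ← mul_sub, abs_mul]
    exact mul_le_mul_of_nonneg_right ((hK r ⟨hr.1.le, hr.2⟩).trans (Real.le_coe_toNNReal K))
      (abs_nonneg _)
  have h := ODE_solution_unique_of_mem_Icc_left (v := fun r x => k r * x) (s := fun _ => univ)
    (f := u) (g := fun _ => 0) hv (hc.mono Icc_subset_Ici_self)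
    (fun r hr => ((hu r hr.1.le).hasDerivAt (Ici_mem_nhds hr.1)).hasDerivWithinAt)
    (fun _ _ => mem_univ _) continuousOn_const
    (fun r _ => by simpa using hasDerivWithinAt_const r (Iic r) (0 : ℝ))
    (fun _ _ => mem_univ _) hs0
  exact h0.ne' (h ⟨le_rfl, hs⟩)

variable {A : ℝ} {lam b : ℝ → ℝ}

theorem derivWithin_const_div (hlam : ContDiffOn ℝ ∞ lam (Ici 0))
    (hpos : ∀ t, 0 ≤ t → 0 < lam t) {t : ℝ} (ht : 0 ≤ t) :
    derivWithin (fun s => A / lam s) (Ici 0) t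
      = -(A * derivWithin lam (Ici 0) t) / lam t ^ 2 := by
  have h1 := (hlam.differentiableOn (by simp) t ht).hasDerivWithinAt
  have h2 := (hasDerivWithinAt_const t (Ici 0) A).div h1 (hpos t ht).ne'
  have h3 := h2.derivWithin (uniqueDiffOn_Ici 0 t ht)
  rw [zero_mul, zero_sub] at h3
  exact h3

theorem integrabilityFactor_eq (hlam : ContDiffOn ℝ ∞ lam (Ici 0))
    (hpos : ∀ t, 0 ≤ t → 0 < lam t) {t : ℝ} (ht : 0 ≤ t) :
    integrabilityFactor (fun s => A / lam s) b t
      = -(A ^ 2 * derivWithin lam (Ici 0) t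
        + A * b t * lam t * (lam t + 2 * t * derivWithin lam (Ici 0) t)) / lam t ^ 3 := by
  have := (hpos t ht).ne'
  rw [integrabilityFactor, derivWithin_const_div hlam hpos ht]
  field_simp
  ring

theorem continuousOn_integrabilityFactor {a : ℝ → ℝ} (ha : ContDiffOn ℝ ∞ a (Ici 0))
    (hb : ContDiffOn ℝ ∞ b (Ici 0)) : ContinuousOn (integrabilityFactor a b) (Ici 0) := by
  have h1 := ha.continuousOn_derivWithin (uniqueDiffOn_Ici 0) (by simp)
  exact ((ha.continuousOn.add ((continuousOn_const.mul continuousOn_id).mul hb.continuousOn)).mul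
    h1).sub (ha.continuousOn.mul hb.continuousOn)

/-- If the integrability factor is the constant `c`, then
`A (a₁ + 2 t b₁) (λ + 2 t λ') = A² - 2 c t λ²`. -/
theorem mul_eq_of_integrabilityFactor_eq (hlam : ContDiffOn ℝ ∞ lam (Ici 0))
    (hpos : ∀ t, 0 ≤ t → 0 < lam t) {c t : ℝ} (ht : 0 ≤ t)
    (hF : integrabilityFactor (fun s => A / lam s) b t = c) :
    A * (A / lam t + 2 * t * b t) * (lam t + 2 * t * derivWithin lam (Ici 0) t)
      = A ^ 2 - 2 * c * t * lam t ^ 2 := by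
  have := (hpos t ht).ne'
  rw [← hF, integrabilityFactor_eq hlam hpos ht]
  field_simp
  ring

theorem pos_of_integrabilityFactor_eq (hA : 0 < A) (hlam : ContDiffOn ℝ ∞ lam (Ici 0))
    (hb : ContDiffOn ℝ ∞ b (Ici 0)) (hpos : ∀ t, 0 ≤ t → 0 < lam t) {c : ℝ}
    (hF : ∀ t, 0 ≤ t → integrabilityFactor (fun s => A / lam s) b t = c)
    (hw : ∀ t, 0 ≤ t → A / lam t + 2 * t * b t ≠ 0) {t : ℝ} (ht : 0 ≤ t) :
    0 < lam t + 2 * t * derivWithin lam (Ici 0) t ∧ 0 < A ^ 2 - 2 * c * t * lam t ^ 2 := by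
  have hwc : ContinuousOn (fun t => A / lam t + 2 * t * b t) (Ici 0) :=
    (continuousOn_const.div hlam.continuousOn fun t ht => (hpos t ht).ne').add
      ((continuousOn_const.mul continuousOn_id).mul hb.continuousOn)
  have hwpos : ∀ t, 0 ≤ t → 0 < A / lam t + 2 * t * b t := fun t ht =>
    pos_of_continuousOn_of_ne_zero (f := fun t => A / lam t + 2 * t * b t) hwc
      (by simpa using div_pos hA (hpos 0 le_rfl)) hw ht
  have hkey := fun t (ht : 0 ≤ t) => mul_eq_of_integrabilityFactor_eq hlam hpos ht (hF t ht)
  have hu : 0 < A ^ 2 - 2 * c * t * lam t ^ 2 := by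
    -- The derivative of u = A² - 2ctλ² is -2cλ(λ + 2tλ'), and `hkey` expresses the bracket as u
    -- divided by A(a₁ + 2tb₁).
    refine pos_of_linear_ode (u := fun t => A ^ 2 - 2 * c * t * lam t ^ 2)
      (k := fun t => -(2 * c * lam t) / (A * (A / lam t + 2 * t * b t))) ?_ ?_
      (by simpa using pow_pos hA 2) ht
    · exact (continuousOn_const.mul hlam.continuousOn).neg.div (continuousOn_const.mul hwc)
        fun t ht => (mul_pos hA (hwpos t ht)).ne'
    · intro s hs
      have h1 := (hlam.differentiableOn (by simp) s hs).hasDerivWithinAt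
      have h2 := (((hasDerivWithinAt_id s (Ici 0)).const_mul (2 * c)).mul (h1.pow 2)).const_sub
        (A ^ 2)
      refine h2.congr_deriv ?_
      rw [← hkey s hs, div_mul_eq_mul_div, eq_div_iff (mul_pos hA (hwpos s hs)).ne']
      simp
      ring
  refine ⟨?_, hu⟩
  rw [← hkey t ht] at hu
  exact pos_of_mul_pos_right hu (mul_pos hA (hwpos t ht)).le

theorem integrabilityFactor_eq_iff (hA : 0 < A) (hlam : ContDiffOn ℝ ∞ lam (Ici 0))
    (hpos : ∀ t, 0 ≤ t → 0 < lam t) {c t : ℝ} (ht : 0 ≤ t)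
    (hD : lam t + 2 * t * derivWithin lam (Ici 0) t ≠ 0) :
    integrabilityFactor (fun s => A / lam s) b t = c ↔
      b t = -(c * lam t ^ 3 + A ^ 2 * derivWithin lam (Ici 0) t) /
            (A * lam t * (lam t + 2 * t * derivWithin lam (Ici 0) t)) := by
  have h1 := (hpos t ht).ne'
  rw [integrabilityFactor_eq hlam hpos ht, div_eq_iff (pow_ne_zero 3 h1),
    eq_div_iff (mul_ne_zero (mul_ne_zero hA.ne' h1) hD)]
  constructor <;> intro h <;> linear_combination -h

end

/-! ### Extraction of the constant c -/

section

variable {n : ℕ} {M : Type*} [TopologicalSpace M] [ChartedSpace (Coord n) M]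
  [IsManifold (𝓡 n) ∞ M]

/-- The energy is quadratic on rays, so t can be prescribed independently of the direction of p. -/
theorem exists_smul_energy_eq (g : Metric n M) {e : OpenPartialHomeomorph M (Coord n)}
    (he : e ∈ IsManifold.maximalAtlas (𝓡 n) ∞ M) {x p : Coord n} (hx : x ∈ e.target) (hp : p ≠ 0)
    {t : ℝ} (ht : 0 < t) : ∃ s : ℝ, 0 < s ∧ energy g e (x, s • p) = t := by
  have h : 0 < energy g e (x, p) := energy_pos g he (z := (x, p)) ⟨hx, mem_univ _⟩ hp
  refine ⟨√(t / energy g e (x, p)), Real.sqrt_pos.2 (div_pos ht h), ?_⟩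
  rw [energy_smul, Real.sq_sqrt (div_pos ht h).le, div_mul_cancel₀ _ h.ne']

theorem exists_chart (n : ℕ) (M : Type*) [TopologicalSpace M] [ChartedSpace (Coord n) M]
    [IsManifold (𝓡 n) ∞ M] [Nonempty M] :
    ∃ e ∈ IsManifold.maximalAtlas (𝓡 n) ∞ M, ∃ x : Coord n, x ∈ e.target := by
  obtain ⟨m⟩ := ‹Nonempty M›
  exact ⟨chartAt (Coord n) m, IsManifold.chart_mem_maximalAtlas m, chartAt (Coord n) m m,
    mem_chart_target _ m⟩

/-- If `J² = -I`, then `a₁ + 2 t b₁` does not vanish for `t > 0`. -/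
theorem IsAlmostComplex.add_ne_zero [Nonempty M] (hn : 0 < n) {g : Metric n M}
    {a₁ a₂ b₁ b₂ : ℝ → ℝ} (hJ : IsAlmostComplex g a₁ a₂ b₁ b₂) {t : ℝ} (ht : 0 < t) :
    a₁ t + 2 * t * b₁ t ≠ 0 := by
  intro h0
  obtain ⟨e, he, x, hx⟩ := exists_chart n M
  obtain ⟨s, hs, hst⟩ := exists_smul_energy_eq g he (p := EuclideanSpace.single ⟨0, hn⟩ 1) hx
    (by simp) ht
  set z : Coord n × Coord n := (x, s • EuclideanSpace.single ⟨0, hn⟩ 1) with hz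
  have hzt : z ∈ inducedTarget e := ⟨hx, mem_univ _⟩
  -- If a₁ + 2tb₁ vanished, the horizontal lift of the raised covector would lie in the kernel of J.
  set w : Coord n × Coord n := ∑ i, raised g e z i • horizontalFrame g e z i with hw
  have h1 : naturalJ g a₁ a₂ b₁ b₂ e z w = 0 := by
    simp only [hw, map_sum, map_smul, naturalJ_horizontalFrame, Finset.smul_sum, smul_smul]
    rw [Finset.sum_comm]
    refine Finset.sum_eq_zero fun j _ => ?_
    rw [← Finset.sum_smul]
    have h2 := dotProduct_raised_lowerCoeff g he a₁ b₁ hzt j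
    rw [hst, h0, zero_mul] at h2
    have h3 : ∑ i, raised g e z i * lowerCoeff g a₁ b₁ e z i j = 0 := by
      rw [← h2]
      exact Finset.sum_congr rfl fun i _ => by rw [lowerCoeff_symm]
    rw [h3, zero_smul]
  have h2 : w = 0 := by
    have := hJ e he z hzt w
    rw [h1, map_zero] at this
    exact neg_eq_zero.1 this.symm
  have h3 : raised g e z = 0 := by
    funext k
    have := congrArg (fun w : Coord n × Coord n => w.1 k) h2
    simpa [hw, horizontalFrame_eq, Prod.fst_sum, Pi.single_apply] using this
  have h4 : energy g e z = 0 := by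
    have : energy g e z = 1 / 2 * dotProduct (raised g e z) z.2 := by
      simp only [dotProduct, raised, energy, Finset.sum_mul]
      rw [Finset.sum_comm]
      congr 1
      exact Finset.sum_congr rfl fun i _ => Finset.sum_congr rfl fun j _ => by ring
    rw [this, h3]
    simp
  rw [hst] at h4
  exact ht.ne' h4

/-- `J` is integrable if and only if the integrability factor is a constant `c` and the curvature
has the space form shape with the constant `c`. -/
theorem isIntegrable_iff_exists [Nonempty M] (hn : 2 ≤ n) (g : Metric n M) {a₁ a₂ b₁ b₂ : ℝ → ℝ}
    (ha₁ : ContDiffOn ℝ ∞ a₁ (Ici 0)) (ha₂ : ContDiffOn ℝ ∞ a₂ (Ici 0))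
    (hb₁ : ContDiffOn ℝ ∞ b₁ (Ici 0)) (hb₂ : ContDiffOn ℝ ∞ b₂ (Ici 0))
    (hJ : IsAlmostComplex g a₁ a₂ b₁ b₂) :
    IsIntegrable g a₁ a₂ b₁ b₂ ↔ ∃ c : ℝ, (∀ e ∈ IsManifold.maximalAtlas (𝓡 n) ∞ M,
      ∀ x ∈ e.target, HasSpaceFormCurvature g e x c) ∧
        ∀ t, 0 ≤ t → integrabilityFactor a₁ b₁ t = c := by
  rw [isIntegrable_iff g ha₁ ha₂ hb₁ hb₂ hJ]
  constructor
  · intro H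
    obtain ⟨e, he, x, hx⟩ := exists_chart n M
    -- Two distinct indices exist because n ≥ 2. For p along the i-th axis the term with pⱼ
    -- disappears, and division by g_{jj} > 0 isolates the factor.
    let i : Fin n := ⟨0, by omega⟩
    let j : Fin n := ⟨1, by omega⟩
    have hij : j ≠ i := by simp [i, j, Fin.ext_iff]
    have hG : 0 < metricMatrix g e x j j := by
      have := metricForm_pos g he hx (u := EuclideanSpace.single j 1) (by simp)
      simpa [metricForm, Pi.single_apply] using this
    have hF : ∀ t, 0 < t → integrabilityFactor a₁ b₁ t
        = curvature g e i j i j x / metricMatrix g e x j j := by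
      intro t ht
      obtain ⟨s, hs, hst⟩ := exists_smul_energy_eq g he (p := EuclideanSpace.single i 1) hx
        (by simp) ht
      have h1 := H e he (x, s • EuclideanSpace.single i 1) ⟨hx, mem_univ _⟩ i j j
      rw [hst] at h1
      simp [hij] at h1
      rw [eq_div_iff hG.ne']
      exact mul_left_cancel₀ hs.ne' (by linarith)
    have hF' : ∀ t, 0 ≤ t → integrabilityFactor a₁ b₁ t
        = curvature g e i j i j x / metricMatrix g e x j j := by
      intro t ht
      -- At t = 0 only p = 0 occurs and the equation is void; the value comes from continuity.
      rcases ht.eq_or_lt with rfl | ht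
      · have h1 := ((continuousOn_integrabilityFactor ha₁ hb₁) 0 (mem_Ici.2 le_rfl)).mono
          Ioi_subset_Ici_self
        have h2 : Filter.Tendsto (integrabilityFactor a₁ b₁) (nhdsWithin 0 (Ioi 0))
            (nhds (curvature g e i j i j x / metricMatrix g e x j j)) :=
          tendsto_const_nhds.congr' (eventually_nhdsWithin_of_forall fun t ht => (hF t ht).symm)
        exact tendsto_nhds_unique h1 h2
      · exact hF t ht
    -- The constant was found at one point, but the factor depends on t alone, so it serves all
    -- charts and points.
    refine ⟨_, fun e' he' y hy p k l h => ?_, hF'⟩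
    have h1 := H e' he' (y, p) ⟨hy, mem_univ _⟩ k l h
    rw [hF' _ (energy_nonneg g he' (z := (y, p)) ⟨hy, mem_univ _⟩)] at h1
    exact h1
  · rintro ⟨c, hc, hF⟩ e he z hz i j h
    rw [hF _ (energy_nonneg g he hz)]
    exact hc e he z.1 hz.1 z.2 i j h

theorem hasConstantSectionalCurvature_iff (g : Metric n M) (c : ℝ) :
    HasConstantSectionalCurvature g c ↔ ∀ e ∈ IsManifold.maximalAtlas (𝓡 n) ∞ M,
      ∀ x ∈ e.target, HasSpaceFormCurvature g e x c :=
  ⟨fun H e he x hx => hasSpaceFormCurvature_of_sectionalCurvature_eq he hx (H e he x hx),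
    fun H e he x hx _ _ huv => (H e he x hx).sectionalCurvature_eq he hx huv⟩

/-- For n ≥ 2 a tangent plane exists and fixes the constant. This identifies a prescribed c with the
one supplied by integrability. -/
theorem HasConstantSectionalCurvature.unique [Nonempty M] (hn : 2 ≤ n) {g : Metric n M} {c c' : ℝ}
    (h : HasConstantSectionalCurvature g c) (h' : HasConstantSectionalCurvature g c') :
    c = c' := by
  obtain ⟨e, he, x, hx⟩ := exists_chart n M
  have hind : LinearIndependent ℝ ![(EuclideanSpace.single ⟨0, by omega⟩ 1 : Coord n),
      EuclideanSpace.single ⟨1, by omega⟩ 1] := by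
    rw [LinearIndependent.pair_iff]
    intro s t hst
    have h0 := congrArg (fun v : Coord n => v ⟨0, by omega⟩) hst
    have h1 := congrArg (fun v : Coord n => v ⟨1, by omega⟩) hst
    simp at h0 h1
    exact ⟨h0, h1⟩
  rw [← h e he x hx _ _ hind, h' e he x hx _ _ hind]

end

end CotangentBundle

end

theorem theorem4 {n : ℕ} (hn : 2 ≤ n) {M : Type*} [TopologicalSpace M] [Nonempty M]
    [ChartedSpace (CotangentBundle.Coord n) M] [IsManifold (𝓡 n) ∞ M]
    (g : CotangentBundle.Metric n M)
    (A : ℝ) (hA : 0 < A)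
    (lam a₂ b₁ b₂ : ℝ → ℝ)
    (hlam : ContDiffOn ℝ ∞ lam (Ici 0)) (ha₂ : ContDiffOn ℝ ∞ a₂ (Ici 0))
    (hb₁ : ContDiffOn ℝ ∞ b₁ (Ici 0)) (hb₂ : ContDiffOn ℝ ∞ b₂ (Ici 0))
    (hlam_pos : ∀ t, 0 ≤ t → 0 < lam t)
    (hJ : CotangentBundle.IsAlmostComplex g (fun t => A / lam t) a₂ b₁ b₂) :
    (CotangentBundle.IsIntegrable g (fun t => A / lam t) a₂ b₁ b₂ ↔
      ∃ c : ℝ, CotangentBundle.HasConstantSectionalCurvature g c ∧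
        ∀ t, 0 ≤ t →
          lam t + 2 * t * derivWithin lam (Ici 0) t ≠ 0 ∧
          b₁ t = -(c * lam t ^ 3 + A ^ 2 * derivWithin lam (Ici 0) t) /
            (A * lam t * (lam t + 2 * t * derivWithin lam (Ici 0) t))) ∧
    (∀ c : ℝ, CotangentBundle.IsIntegrable g (fun t => A / lam t) a₂ b₁ b₂ →
      CotangentBundle.HasConstantSectionalCurvature g c →
        0 < A ∧ ∀ t, 0 ≤ t → 0 < lam t ∧
          0 < (A ^ 2 - 2 * c * t * lam t ^ 2) /
            (lam t + 2 * t * derivWithin lam (Ici 0) t)) := by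
  have ha₁ : ContDiffOn ℝ ∞ (fun t => A / lam t) (Ici 0) :=
    contDiffOn_const.div hlam fun t ht => (hlam_pos t ht).ne'
  have hint := CotangentBundle.isIntegrable_iff_exists hn g ha₁ ha₂ hb₁ hb₂ hJ
  -- Invertibility of J settles t > 0; at t = 0 the expression is A/λ(0).
  have hw : ∀ t, 0 ≤ t → A / lam t + 2 * t * b₁ t ≠ 0 := by
    intro t ht
    rcases ht.eq_or_lt with rfl | ht
    · simpa using ⟨hA.ne', (hlam_pos 0 le_rfl).ne'⟩
    · exact hJ.add_ne_zero (by omega) ht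
  have hpos := fun c hF t ht => CotangentBundle.pos_of_integrabilityFactor_eq (c := c) (t := t) hA
    hlam hb₁ hlam_pos hF hw ht
  refine ⟨hint.trans (exists_congr fun c => ?_), fun c hI hc => ⟨hA, fun t ht => ?_⟩⟩
  · rw [← CotangentBundle.hasConstantSectionalCurvature_iff]
    refine and_congr_right fun _ => ⟨fun hF t ht => ?_, fun h t ht => ?_⟩
    · have hD := (hpos c hF t ht).1.ne'
      exact ⟨hD, (CotangentBundle.integrabilityFactor_eq_iff hA hlam hlam_pos ht hD).1 (hF t ht)⟩
    · exact (CotangentBundle.integrabilityFactor_eq_iff hA hlam hlam_pos ht (h t ht).1).2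
        (h t ht).2
  · obtain ⟨c', hc', hF⟩ := hint.1 hI
    obtain rfl := hc.unique hn ((CotangentBundle.hasConstantSectionalCurvature_iff g c').2 hc')
    have h := hpos c hF t ht
    exact ⟨hlam_pos t ht, div_pos h.2 h.1⟩
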